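/- \textbf{Setting.} Let $F:\mathbb R^d\to\mathbb R^d$ satisfy $F(x^*)=0$ and $\|F(x)-F(y)\|\le C\|x-y\|$ for all $x,y$ (Euclidean norm, $C>0$). Let $V:\mathbb R^d\to\mathbb R$ be locally Lipschitz, and let $\partial V(x)$ be its Clarke generalized gradient, i.e. the closed convex hull of all limits $\lim_i\nabla V(y_i)$ with $y_i\to x$ and $V$ differentiable at each $y_i$. Assume that there are constants $a,\gamma,G,C_1,C_2>0$ such that for all $x\in\mathbb R^d$ and all $g\in\partial V(x)$ $$\langle g,F(x)\rangle\le-\gamma V(x),\qquad C_1\|x-x^*\|^a\le V(x)\le C_2\|x-x^*\|^a,\qquad \|g\|\le G\|x-x^*\|^{a-1}.$$ Let $\alpha>0$, $\xi\in[0,1]$, $K\ge1$, $\alpha_k=\alpha/(k+K)^{\xi}$, and let $$x_{k+1}=x_k+\alpha_k\,(F(x_k)+w_k),\qquad k\ge0,$$ where $x_0$ and all $w_k$ are square-integrable random vectors and, with $\mathcal F_k=\sigma(x_0,w_0,\dots,x_{k-1},w_{k-1},x_k)$ and constants $A,B\ge0$, almost surely $$\mathbb E[w_k\mid\mathcal F_k]=0,\qquad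 \mathbb E[\|w_k\|^2\mid\mathcal F_k]\le A+B\|x_k\|^2\qquad(k\ge0).$$ For $\mu>0$ let $M_\mu(x)=\min_u\{V(u)^{2/a}+\|x-u\|^2/(2\mu)\}$ be the Moreau envelope of $V^{2/a}$, and put $$G_M=\tfrac2a\,G\,\max\{C_1^{2/a-1},C_2^{2/a-1}\},\qquad \gamma_M=\Big[\frac{2\gamma C_1^{2/a}}{a(1+\mu G_M)^2}-\mu C G_M^2\Big]C_2^{-2/a},$$ $$c=\frac1{C_1^{2/a}}+2\mu,\qquad D=\frac{A+2B\|x^*\|^2}{\mu},\qquad \bar\alpha=\frac{\gamma_M\,\mu}{2(C^2+2B)\,c}.$$ \textbf{Theorem.} For all sufficiently small $\mu>0$ one has $0<\gamma_M<\frac{2\gamma}{a}(C_1/C_2)^{2/a}$. For every $\mu>0$ with $\gamma_M>0$, the number $\gamma_M$ is a drift constant of $M_\mu$, that is, $\langle g,F(x)\rangle\le-\gamma_M M_\mu(x)$ for all $x\in\mathbb R^d$ and all $g$ in the Clarke generalized gradient of $M_\mu$ at $x$ (in particular for $g=\nabla M_\mu(x)$ wherever $M_\mu$ is differentiable). Moreover,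 for every such $\mu$ and every $k\ge0$, $\|x_k-x^*\|^2$ is integrable, and with $E_0=\mathbb E\|x_0-x^*\|^2$ (equal to $\|x_0-x^*\|^2$ if $x_0$ is deterministic) the following hold. (i) If $\xi=1$ and $K\ge\max\{1,\alpha/\bar\alpha\}$, then $$\mathbb E\|x_k-x^*\|^2\le C_2^{2/a}\,c\,E_0\Big(\frac K{k+K}\Big)^{\alpha\gamma_M/2}+c\,D\cdot\begin{cases}\dfrac{8\alpha^2}{2-\alpha\gamma_M}\dfrac1{(k+K)^{\alpha\gamma_M/2}},&0<\alpha<2/\gamma_M,\\[2mm]\dfrac{4\alpha^2\log(k+K)}{k+K},&\alpha=2/\gamma_M,\\[2mm]\dfrac{8e\alpha^2}{\alpha\gamma_M-2}\dfrac1{k+K},&\alpha>2/\gamma_M.\end{cases}$$ (ii) If $0<\xi<1$ and $K\ge\max\{1,(\alpha/\bar\alpha)^{1/\xi},(4\xi/(\alpha\gamma_M))^{1/(1-\xi)}\}$, then $$\mathbb E\|x_k-x^*\|^2\le C_2^{2/a}\,c\,E_0\exp\Big[-\frac{\alpha\gamma_M}{2(1-\xi)}\big((k+K)^{1-\xi}-K^{1-\xi}\big)\Big]+\frac{4\alpha\,c\,D}{\gamma_M(k+K)^{\xi}}.$$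 (iii) If $\xi=0$ and $\alpha\le\bar\alpha$, then $$\mathbb E\|x_k-x^*\|^2\le C_2^{2/a}\,c\,E_0\Big(1-\frac{\alpha\gamma_M}2\Big)^k+\frac{2\alpha\,c\,D}{\gamma_M}.$$ In particular the second term is $O(1/k)$ for $\xi=1$ and $\alpha>2/\gamma_M$, $O(1/k^\xi)$ for $0<\xi<1$, and for $\xi=0$ the iterates converge exponentially fast in mean square to a ball. -/

import Mathlib

open Set Filter Topology MeasureTheory ProbabilityTheory

noncomputable section

/-- Clarke's generalized gradient of `V` at `x`: the closed convex hull of all limits of gradients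
`∇ V (y i)` along sequences `y i → x` of points at which `V` is differentiable. -/
def clarkeGradient {d : ℕ} (V : EuclideanSpace ℝ (Fin d) → ℝ) (x : EuclideanSpace ℝ (Fin d)) :
    Set (EuclideanSpace ℝ (Fin d)) :=
  closure (convexHull ℝ {g | ∃ y : ℕ → EuclideanSpace ℝ (Fin d),
    (∀ i, DifferentiableAt ℝ V (y i)) ∧ Tendsto y atTop (𝓝 x) ∧
      Tendsto (fun i => gradient V (y i)) atTop (𝓝 g)})

/-- The Moreau envelope `x ↦ inf_u (R u + ‖x - u‖² / (2 μ))`. -/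
def moreauEnvelope {d : ℕ} (R : EuclideanSpace ℝ (Fin d) → ℝ) (μ : ℝ)
    (x : EuclideanSpace ℝ (Fin d)) : ℝ :=
  ⨅ u : EuclideanSpace ℝ (Fin d), (R u + ‖x - u‖ ^ 2 / (2 * μ))

/-- The history `σ(x₀, w₀, …, x_{k-1}, w_{k-1}, x_k)` of the iterates and the noise. -/
@[reducible] def history {Ω : Type*} {d : ℕ} (x w : ℕ → Ω → EuclideanSpace ℝ (Fin d)) (k : ℕ) :
    MeasurableSpace Ω :=
  (⨆ i ∈ Set.Iic k, MeasurableSpace.comap (x i) inferInstance) ⊔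
    (⨆ i ∈ Set.Iio k, MeasurableSpace.comap (w i) inferInstance)

/-- The linear growth constant `G_M` of the generalized gradient of `V ^ (2 / a)`.
The maximum is `C₂ ^ (2 / a - 1)` for `a ≤ 2` and `C₁ ^ (2 / a - 1)` for `a ≥ 2`
(when `C₁ ≤ C₂`). -/
def gradientConst (a G C₁ C₂ : ℝ) : ℝ :=
  2 / a * G * max (C₁ ^ (2 / a - 1)) (C₂ ^ (2 / a - 1))

/-- The drift constant `γ_M` of the Moreau envelope of `V ^ (2 / a)` with parameter `μ`. -/
def driftConst (a γ C G C₁ C₂ μ : ℝ) : ℝ :=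
  (2 * γ * C₁ ^ (2 / a) / (a * (1 + μ * gradientConst a G C₁ C₂) ^ 2)
    - μ * C * gradientConst a G C₁ C₂ ^ 2) * C₂ ^ (-(2 / a))

/-- The factor `1 / C₁ ^ (2 / a) + 2 μ` by which the squared distance to the equilibrium is
compared with the Moreau envelope. -/
def envelopeConst (a C₁ μ : ℝ) : ℝ := 1 / C₁ ^ (2 / a) + 2 * μ

/-- The largest admissible step size: for steps `≤ maxStep` the second order term of the one step
recursion is at most half of the drift term. -/
def maxStep (a γ C G C₁ C₂ B μ : ℝ) : ℝ :=
  driftConst a γ C G C₁ C₂ μ * μ / (2 * (C ^ 2 + 2 * B) * envelopeConst a C₁ μ)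

end

/-! Write `R = V ^ (2 / a)`, which lies between two multiples of `‖x - xs‖ ^ 2`, and let `M` be its
Moreau envelope. `R` need not be convex, so `M` need not be differentiable. However, `M - ‖·‖² /
(2μ)` is an infimum of affine functions, hence concave. This one-sided smoothness is all that an
upper bound along the iterates needs, and the vector `p = (x - u) / μ`, for any minimizer `u` in the
definition of `M x`, replaces the gradient.

Drift. The vector `p` is also a proximal subgradient of `R` at `u`. By the chain rule a positive
multiple of it is a subgradient of `V` at `u`, and a Hahn–Banach argument places it in the Clarke
gradient (`smul_prox_mem_clarkeGradient`). The hypotheses on `V` therefore control `⟨p, F u⟩` and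
`‖p‖` at `u`. Replacing `F u` by `F x` costs at most `C ‖x - u‖ ‖p‖ = μ C ‖p‖²`, which is small with
`μ`; this is `inner_prox_le_driftConst`. Limits and convex combinations carry the inequality to the
Clarke gradient of `M`.

One step. The deterministic move is handled by the quadratic upper bound with slope `p`. The
centered noise is handled by conditional Jensen for the concave part, which leaves only its variance
(`integral_moreauEnvelope_add_smul_le`). For admissible steps the second order terms are absorbed
into the drift, so that `u k = E M (x k)` satisfies `u (k + 1) ≤ (1 - β γ / 2) u k + β² D` with `β`
the current step and `γ` the drift constant.

Rates. Such a recursion is compared with explicit supersolutions, one for each step size regime. The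
bounds `‖x - xs‖² ≤ c M x` and `M x ≤ C₂ ^ (2 / a) ‖x - xs‖²` translate the result back to mean
squares. -/

/-! ### The Moreau envelope and its proximal points -/

theorem moreauEnvelope_le {d : ℕ} {R : EuclideanSpace ℝ (Fin d) → ℝ} (hR : ∀ x, 0 ≤ R x)
    {μ : ℝ} (hμ : 0 < μ) (x u : EuclideanSpace ℝ (Fin d)) :
    moreauEnvelope R μ x ≤ R u + ‖x - u‖ ^ 2 / (2 * μ) := by
  refine ciInf_le ⟨0, ?_⟩ u
  rintro _ ⟨z, rfl⟩
  have := hR z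
  positivity

/-- The quadratic term is coercive and `R` is nonnegative, so the infimum is attained. The minimizer
need not be unique; every later use accepts any choice. -/
theorem exists_moreauEnvelope_eq {d : ℕ} {R : EuclideanSpace ℝ (Fin d) → ℝ}
    (hR : ∀ x, 0 ≤ R x) (hRc : Continuous R) {μ : ℝ} (hμ : 0 < μ)
    (x : EuclideanSpace ℝ (Fin d)) :
    ∃ u, moreauEnvelope R μ x = R u + ‖x - u‖ ^ 2 / (2 * μ) := by
  have hlim : Tendsto (fun u => R u + ‖x - u‖ ^ 2 / (2 * μ))
      (cocompact (EuclideanSpace ℝ (Fin d))) atTop := by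
    refine tendsto_atTop_mono (fun u => le_add_of_nonneg_left (hR u)) ?_
    refine Tendsto.atTop_div_const (by positivity) ?_
    refine (tendsto_pow_atTop two_ne_zero).comp ?_
    have h := (tendsto_norm_cocompact_atTop (E := EuclideanSpace ℝ (Fin d))).comp
      (Homeomorph.subLeft x).isClosedEmbedding.tendsto_cocompact
    exact h
  obtain ⟨u, hu⟩ := Continuous.exists_forall_le (by fun_prop) hlim
  exact ⟨u, le_antisymm (moreauEnvelope_le hR hμ x u) (le_ciInf hu)⟩

/-- The Moreau envelope lies below the quadratic with curvature `1 / μ` that touches it at `x`. -/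
theorem moreauEnvelope_le_add_inner {d : ℕ} {R : EuclideanSpace ℝ (Fin d) → ℝ}
    (hR : ∀ x, 0 ≤ R x) {μ : ℝ} (hμ : 0 < μ) {x u : EuclideanSpace ℝ (Fin d)}
    (hu : moreauEnvelope R μ x = R u + ‖x - u‖ ^ 2 / (2 * μ)) (z : EuclideanSpace ℝ (Fin d)) :
    moreauEnvelope R μ z ≤ moreauEnvelope R μ x + inner ℝ (μ⁻¹ • (x - u)) (z - x)
      + ‖z - x‖ ^ 2 / (2 * μ) := by
  refine (moreauEnvelope_le hR hμ z u).trans (le_of_eq ?_)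
  have h : z - u = (x - u) + (z - x) := by abel
  rw [hu, h, norm_add_sq_real, real_inner_smul_left]
  field_simp
  ring

/-- Expanding `‖x - u‖²` and removing `‖x‖² / (2μ)` leaves, for each fixed `u`, an affine function
of `x`; an infimum of affine functions is concave. -/
theorem concaveOn_moreauEnvelope_sub {d : ℕ} {R : EuclideanSpace ℝ (Fin d) → ℝ}
    (hR : ∀ x, 0 ≤ R x) (hRc : Continuous R) {μ : ℝ} (hμ : 0 < μ) :
    ConcaveOn ℝ univ (fun x => moreauEnvelope R μ x - ‖x‖ ^ 2 / (2 * μ)) := by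
  refine ⟨convex_univ, fun x _ y _ s t hs ht hst => ?_⟩
  obtain ⟨u, hu⟩ := exists_moreauEnvelope_eq hR hRc hμ (s • x + t • y)
  have key : ∀ z : EuclideanSpace ℝ (Fin d), R u + ‖z - u‖ ^ 2 / (2 * μ) - ‖z‖ ^ 2 / (2 * μ)
      = R u + ‖u‖ ^ 2 / (2 * μ) - inner ℝ z u / μ := by
    intro z
    rw [norm_sub_sq_real]
    field_simp
    ring
  have hx := moreauEnvelope_le hR hμ x u
  have hy := moreauEnvelope_le hR hμ y u
  have kx := key x
  have ky := key y
  simp only [hu, key, smul_eq_mul, inner_add_left, real_inner_smul_left]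
  calc _ ≤ s * (R u + ‖u‖ ^ 2 / (2 * μ) - inner ℝ x u / μ)
        + t * (R u + ‖u‖ ^ 2 / (2 * μ) - inner ℝ y u / μ) := by
        have h1 := mul_le_mul_of_nonneg_left (sub_le_sub_right hx (‖x‖ ^ 2 / (2 * μ))) hs
        have h2 := mul_le_mul_of_nonneg_left (sub_le_sub_right hy (‖y‖ ^ 2 / (2 * μ))) ht
        rw [kx] at h1
        rw [ky] at h2
        exact add_le_add h1 h2
    _ = _ := by
        have : t = 1 - s := by linarith
        subst this
        ring

theorem continuous_moreauEnvelope {d : ℕ} {R : EuclideanSpace ℝ (Fin d) → ℝ}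
    (hR : ∀ x, 0 ≤ R x) (hRc : Continuous R) {μ : ℝ} (hμ : 0 < μ) :
    Continuous (moreauEnvelope R μ) := by
  have h := (concaveOn_moreauEnvelope_sub hR hRc hμ).locallyLipschitz.continuous
  have h2 : Continuous fun x : EuclideanSpace ℝ (Fin d) => ‖x‖ ^ 2 / (2 * μ) := by fun_prop
  exact (h.add h2).congr fun x => by simp

/-- The paraboloid centred at the proximal point touches the envelope from above at `x`, so the two
derivatives agree there. -/
theorem gradient_moreauEnvelope {d : ℕ} {R : EuclideanSpace ℝ (Fin d) → ℝ}
    (hR : ∀ x, 0 ≤ R x) {μ : ℝ} (hμ : 0 < μ) {x u : EuclideanSpace ℝ (Fin d)}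
    (hu : moreauEnvelope R μ x = R u + ‖x - u‖ ^ 2 / (2 * μ))
    (hd : DifferentiableAt ℝ (moreauEnvelope R μ) x) :
    gradient (moreauEnvelope R μ) x = μ⁻¹ • (x - u) := by
  have hq : HasFDerivAt (fun z => R u + ‖z - u‖ ^ 2 / (2 * μ))
      (InnerProductSpace.toDual ℝ _ (μ⁻¹ • (x - u))) x := by
    have h1 : HasFDerivAt (fun z : EuclideanSpace ℝ (Fin d) => z - u)
      (ContinuousLinearMap.id ℝ _) x := (hasFDerivAt_id x).sub_const u
    have h2 := ((h1.norm_sq).mul_const (2 * μ)⁻¹).const_add (R u)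
    refine (h2.congr_fderiv ?_)
    ext v
    simp
    field_simp
  have hmin : IsLocalMin (fun z => R u + ‖z - u‖ ^ 2 / (2 * μ) - moreauEnvelope R μ z) x := by
    refine Filter.Eventually.of_forall fun z => ?_
    have := moreauEnvelope_le hR hμ z u
    simp only [hu]
    linarith
  have h0 := hmin.hasFDerivAt_eq_zero (hq.sub hd.hasFDerivAt)
  rw [gradient, ← sub_eq_zero.mp h0]
  simp

theorem sq_norm_sub_le_moreauEnvelope {d : ℕ} {R : EuclideanSpace ℝ (Fin d) → ℝ}
    {c₁ : ℝ} (hc₁ : 0 < c₁) {xs : EuclideanSpace ℝ (Fin d)} (hR : ∀ x, c₁ * ‖x - xs‖ ^ 2 ≤ R x)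
    {μ : ℝ} (hμ : 0 < μ) (x : EuclideanSpace ℝ (Fin d)) :
    ‖x - xs‖ ^ 2 ≤ (1 / c₁ + 2 * μ) * moreauEnvelope R μ x := by
  have hc : 0 < 1 / c₁ + 2 * μ := by positivity
  rw [← div_le_iff₀' hc]
  refine le_ciInf fun u => ?_
  refine le_trans ?_ (add_le_add_left (hR u) _)
  have h : ‖x - xs‖ ≤ ‖u - xs‖ + ‖x - u‖ := by
    have := norm_add_le (u - xs) (x - u)
    rwa [show u - xs + (x - u) = x - xs by abel] at this
  have h2 : ‖x - xs‖ ^ 2 ≤ (‖u - xs‖ + ‖x - u‖) ^ 2 := by gcongr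
  refine (div_le_div_of_nonneg_right h2 hc.le).trans ?_
  rw [div_le_iff₀ hc]
  -- The weighted Cauchy–Schwarz inequality, with its defect written as a square; it is the source
  -- of the factor `1 / c₁ + 2 * μ`.
  have h3 : (c₁ * ‖u - xs‖ ^ 2 + ‖x - u‖ ^ 2 / (2 * μ)) * (1 / c₁ + 2 * μ)
      - (‖u - xs‖ + ‖x - u‖) ^ 2
      = (2 * μ * c₁ * ‖u - xs‖ - ‖x - u‖) ^ 2 / (2 * μ * c₁) := by
    field_simp
    ring
  have : 0 ≤ (2 * μ * c₁ * ‖u - xs‖ - ‖x - u‖) ^ 2 / (2 * μ * c₁) := by positivity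
  linarith

theorem moreauEnvelope_nonneg {d : ℕ} {R : EuclideanSpace ℝ (Fin d) → ℝ}
    (hR : ∀ x, 0 ≤ R x) {μ : ℝ} (hμ : 0 < μ) (x : EuclideanSpace ℝ (Fin d)) :
    0 ≤ moreauEnvelope R μ x :=
  le_ciInf fun u => by have := hR u; positivity

theorem moreauEnvelope_le_self {d : ℕ} {R : EuclideanSpace ℝ (Fin d) → ℝ}
    (hR : ∀ x, 0 ≤ R x) {μ : ℝ} (hμ : 0 < μ) (x : EuclideanSpace ℝ (Fin d)) :
    moreauEnvelope R μ x ≤ R x := by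
  simpa using moreauEnvelope_le hR hμ x x

/-! ### Subgradients and Clarke's generalized gradient -/

/-- The segment from `u` may miss every point of differentiability, so the mean value theorem is not
applied to `V` along it. It is applied instead to the integral of `V` over small translates of the
segment. By Rademacher's theorem and dominated convergence this integral is differentiable in `τ`,
with the expected derivative. If the claim failed at `u`, by continuity it would fail with a margin
for all nearby translates, contradicting the integrated bound. -/
theorem LipschitzWith.sub_le_of_fderiv_le {E : Type*} [NormedAddCommGroup E] [NormedSpace ℝ E]
    [FiniteDimensional ℝ E] [MeasurableSpace E] [BorelSpace E] {V : E → ℝ} {L : NNReal}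
    (hV : LipschitzWith L V) {u v : E} {r s t : ℝ}
    (hs : ∀ y ∈ Metric.ball u r, DifferentiableAt ℝ V y → fderiv ℝ V y v ≤ s)
    (ht : 0 ≤ t) (htr : t * ‖v‖ < r) : V (u + t • v) - V u ≤ t * s := by
  by_contra! hlt
  let ν : Measure E := Measure.addHaar
  obtain ⟨ε, hε, hεlt⟩ := exists_between hlt
  have hcont : Continuous fun z => V (u + z + t • v) - V (u + z) := by
    have := hV.continuous
    fun_prop
  have hev : ∀ᶠ z in 𝓝 (0 : E), ε < V (u + z + t • v) - V (u + z) :=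
    hcont.continuousAt.eventually (lt_mem_nhds (by simpa using hεlt))
  obtain ⟨δ₀, hδ₀, hball⟩ := Metric.eventually_nhds_iff_ball.mp hev
  set δ := min δ₀ (r - t * ‖v‖) with hδ
  have hδpos : 0 < δ := lt_min hδ₀ (by linarith)
  set S : Set E := Metric.ball 0 δ with hS
  have hSfin : ν S ≠ ⊤ := measure_ball_lt_top.ne
  have hSpos : 0 < ν.real S :=
    ENNReal.toReal_pos (Metric.measure_ball_pos ν 0 hδpos).ne' hSfin
  have hint : ∀ τ : ℝ, IntegrableOn (fun z => V (u + z + τ • v)) S ν := by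
    intro τ
    have hc : Continuous fun z => V (u + z + τ • v) := by
      have := hV.continuous
      fun_prop
    exact (hc.continuousOn.integrableOn_compact (isCompact_closedBall 0 δ)).mono_set
      Metric.ball_subset_closedBall
  have hderiv : ∀ τ : ℝ, ∃ F' : E → ℝ, IntegrableOn F' S ν ∧
      (∀ᵐ z ∂ν, DifferentiableAt ℝ V (u + z + τ • v) ∧ F' z = fderiv ℝ V (u + z + τ • v) v) ∧
      HasDerivAt (fun τ : ℝ => ∫ z in S, V (u + z + τ • v) ∂ν) (∫ z in S, F' z ∂ν) τ := by
    intro τ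
    have hae : ∀ᵐ z ∂ν, DifferentiableAt ℝ V (u + z + τ • v) := by
      have h := (measurePreserving_add_left ν (u + τ • v)).quasiMeasurePreserving.ae
        hV.ae_differentiableAt
      filter_upwards [h] with z hz
      rwa [show u + z + τ • v = u + τ • v + z by abel]
    have hmeas : Measurable fun z => fderiv ℝ V (u + z + τ • v) v :=
      (measurable_fderiv_apply_const ℝ V v).comp (by fun_prop)
    have h := hasDerivAt_integral_of_dominated_loc_of_lip (μ := ν.restrict S) (𝕜 := ℝ)
      (F := fun (τ : ℝ) z => V (u + z + τ • v))
      (F' := fun z => fderiv ℝ V (u + z + τ • v) v) (x₀ := τ)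
      (bound := fun _ => L * ‖v‖) (s := univ) univ_mem
      (Eventually.of_forall fun τ => (hint τ).aestronglyMeasurable) (hint τ)
      hmeas.aestronglyMeasurable
      (Eventually.of_forall fun z => by
        refine LipschitzOnWith.of_dist_le_mul fun σ _ σ' _ => ?_
        refine (hV.dist_le_mul _ _).trans (le_of_eq ?_)
        rw [dist_add_left, dist_eq_norm, ← sub_smul, norm_smul, Real.dist_eq, Real.norm_eq_abs,
          Real.coe_nnabs, abs_of_nonneg (mul_nonneg L.coe_nonneg (norm_nonneg v))]
        ring)
      (integrableOn_const hSfin)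
      (ae_restrict_of_ae (hae.mono fun z hz => by
        have h1 : HasDerivAt (fun τ : ℝ => u + z + τ • v) v τ := by
          simpa using ((hasDerivAt_id τ).smul_const v).const_add (u + z)
        exact hz.hasFDerivAt.comp_hasDerivAt τ h1))
    exact ⟨_, h.1, hae.mono fun z hz => ⟨hz, rfl⟩, h.2⟩
  choose F' hF'int hF'ae hF' using hderiv
  have hle : ∀ τ ∈ Ioo 0 t, ∫ z in S, F' τ z ∂ν ≤ ν.real S * s := by
    intro τ hτ
    have : ∫ z in S, F' τ z ∂ν ≤ ∫ z in S, s ∂ν := by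
      refine setIntegral_mono_on_ae (hF'int τ) (integrableOn_const hSfin) measurableSet_ball ?_
      filter_upwards [hF'ae τ] with z hz hzS
      rw [hz.2]
      refine hs _ ?_ hz.1
      rw [mem_ball_iff_norm, show u + z + τ • v - u = z + τ • v by abel]
      have h1 : ‖z‖ < δ := by simpa [hS] using hzS
      have h2 : ‖τ • v‖ ≤ t * ‖v‖ := by
        rw [norm_smul, Real.norm_of_nonneg hτ.1.le]
        exact mul_le_mul_of_nonneg_right hτ.2.le (norm_nonneg v)
      have h3 : δ ≤ r - t * ‖v‖ := min_le_right _ _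
      linarith [norm_add_le z (τ • v)]
    simpa [mul_comm] using this
  have hmvt := Convex.image_sub_le_mul_sub_of_deriv_le (convex_Icc 0 t)
    (f := fun τ : ℝ => ∫ z in S, V (u + z + τ • v) ∂ν)
    (fun τ _ => (hF' τ).continuousAt.continuousWithinAt)
    (fun τ _ => (hF' τ).differentiableAt.differentiableWithinAt)
    (C := ν.real S * s)
    (fun τ hτ => by
      rw [interior_Icc] at hτ
      rw [(hF' τ).deriv]
      exact hle τ hτ) 0 (left_mem_Icc.2 ht) t (right_mem_Icc.2 ht) ht
  have hlow : ν.real S * ε ≤ ∫ z in S, (V (u + z + t • v) - V (u + z + (0 : ℝ) • v)) ∂ν := by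
    have : ∫ z in S, ε ∂ν ≤ ∫ z in S, (V (u + z + t • v) - V (u + z + (0 : ℝ) • v)) ∂ν := by
      refine setIntegral_mono_on (integrableOn_const hSfin) ((hint t).sub (hint 0))
        measurableSet_ball fun z hz => ?_
      have := hball z (Metric.ball_subset_ball (min_le_left _ _) hz)
      simpa using this.le
    simpa using this
  rw [integral_sub (hint t) (hint 0)] at hlow
  have : ν.real S * ε ≤ ν.real S * (t * s) := by
    simp only [sub_zero] at hmvt
    linarith
  have := le_of_mul_le_mul_left this hSpos
  linarith

/-- A global Lipschitz extension agrees with `V` on the open ball, hence has the same derivatives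
there. -/
theorem LipschitzOnWith.sub_le_of_fderiv_le {E : Type*} [NormedAddCommGroup E] [NormedSpace ℝ E]
    [FiniteDimensional ℝ E] {V : E → ℝ} {L : NNReal} {u v : E} {r s t : ℝ}
    (hV : LipschitzOnWith L V (Metric.ball u r))
    (hs : ∀ y ∈ Metric.ball u r, DifferentiableAt ℝ V y → fderiv ℝ V y v ≤ s)
    (ht : 0 ≤ t) (htr : t * ‖v‖ < r) : V (u + t • v) - V u ≤ t * s := by
  borelize E
  obtain ⟨g, hg, heq⟩ := hV.extend_real
  have hr : 0 < r := lt_of_le_of_lt (by positivity) htr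
  have h1 : u + t • v ∈ Metric.ball u r := by
    rw [mem_ball_iff_norm]
    simpa [norm_smul, abs_of_nonneg ht] using htr
  rw [heq h1, heq (Metric.mem_ball_self hr)]
  refine hg.sub_le_of_fderiv_le (r := r) (fun y hy hd => ?_) ht htr
  have hev : V =ᶠ[𝓝 y] g :=
    heq.eventuallyEq_of_mem (Metric.isOpen_ball.mem_nhds hy)
  rw [← hev.fderiv_eq]
  exact hs y hy (hd.congr_of_eventuallyEq hev)

/-- A Fréchet subgradient of a locally Lipschitz function, witnessed by a differentiable function
touching from below, lies in Clarke's generalized gradient. -/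
theorem mem_clarkeGradient_of_hasGradientAt {d : ℕ} {V Q : EuclideanSpace ℝ (Fin d) → ℝ}
    (hV : LocallyLipschitz V) {u p : EuclideanSpace ℝ (Fin d)} (hQ : HasGradientAt Q p u)
    (hQu : Q u = V u) (hQV : ∀ᶠ z in 𝓝 u, Q z ≤ V z) : p ∈ clarkeGradient V u := by
  by_contra hp
  obtain ⟨f, s, hfs, hsp⟩ := geometric_hahn_banach_closed_point
    (convex_convexHull ℝ _).closure isClosed_closure hp
  obtain ⟨L, T, hT, hLT⟩ := hV u
  set v := (InnerProductSpace.toDual ℝ (EuclideanSpace ℝ (Fin d))).symm f with hv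
  have hf : ∀ y, f y = inner ℝ v y := fun y => by simp [hv]
  obtain ⟨r₀, hr₀, hrT⟩ := Metric.mem_nhds_iff.mp hT
  -- The functional `f = ⟨v, ·⟩` strictly separates `p` from the Clarke gradient. Near `u` all
  -- gradients must lie on the side `f ≤ s`. Otherwise violating gradients, bounded by the Lipschitz
  -- constant, would have a subsequential limit in the Clarke gradient with `f ≥ s`.
  have hgrad : ∃ r, 0 < r ∧ r ≤ r₀ ∧ ∀ y ∈ Metric.ball u r, DifferentiableAt ℝ V y →
      fderiv ℝ V y v ≤ s := by
    by_contra! hcon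
    have hpos : ∀ n : ℕ, 0 < min r₀ (1 / ((n : ℝ) + 1)) := fun n => lt_min hr₀ (by positivity)
    choose y hy hyd hys using fun n : ℕ => hcon _ (hpos n) (min_le_left _ _)
    have hylim : Tendsto y atTop (𝓝 u) := by
      rw [tendsto_iff_dist_tendsto_zero]
      refine squeeze_zero (fun n => dist_nonneg) (fun n => ?_)
        (tendsto_one_div_add_atTop_nhds_zero_nat (𝕜 := ℝ))
      exact (hy n).le.trans (min_le_right _ _)
    have hbd : ∀ n, gradient V (y n) ∈ Metric.closedBall (0 : EuclideanSpace ℝ (Fin d)) L := by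
      intro n
      rw [mem_closedBall_zero_iff, gradient, LinearIsometryEquiv.norm_map]
      refine norm_fderiv_le_of_lipschitzOn ℝ (s := T) ?_ hLT
      refine mem_of_superset (Metric.isOpen_ball.mem_nhds ?_) hrT
      exact Metric.ball_subset_ball (min_le_left _ _) (hy n)
    obtain ⟨g, -, φ, hφ, hg⟩ := (isCompact_closedBall _ _).tendsto_subseq hbd
    have hgmem : g ∈ clarkeGradient V u := subset_closure (subset_convexHull ℝ _
      ⟨y ∘ φ, fun i => hyd _, hylim.comp hφ.tendsto_atTop, hg⟩)
    have h1 := hfs g hgmem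
    have h2 : s ≤ f g := by
      refine ge_of_tendsto ((f.continuous.tendsto g).comp hg) (Eventually.of_forall fun n => ?_)
      have := hys (φ n)
      rw [Function.comp_apply, Function.comp_apply, hf, real_inner_comm, inner_gradient_left]
      exact this.le
    linarith
  obtain ⟨r, hr, hrr₀, hrs⟩ := hgrad
  have hLip : LipschitzOnWith L V (Metric.ball u r) :=
    hLT.mono ((Metric.ball_subset_ball hrr₀).trans hrT)
  have hline : HasDerivAt (fun t : ℝ => u + t • v) v 0 := by
    simpa using ((hasDerivAt_id (0 : ℝ)).smul_const v).const_add u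
  have hQline : HasDerivAt (fun t : ℝ => Q (u + t • v)) (f p) 0 := by
    have h := HasFDerivAt.comp_hasDerivAt_of_eq (0 : ℝ) hQ.hasFDerivAt hline (by simp)
    rw [hf, real_inner_comm]
    rwa [InnerProductSpace.toDual_apply_apply] at h
  have hlim := hQline.tendsto_slope_zero_right
  have hev1 : ∀ᶠ t in 𝓝 (0 : ℝ), Q (u + t • v) ≤ V (u + t • v) := by
    have := hline.continuousAt.tendsto
    rw [zero_smul, add_zero] at this
    exact this.eventually hQV
  have hev2 : ∀ᶠ t in 𝓝 (0 : ℝ), t * ‖v‖ < r := by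
    have : Tendsto (fun t : ℝ => t * ‖v‖) (𝓝 0) (𝓝 (0 * ‖v‖)) := by
      exact (continuous_id.mul continuous_const).tendsto 0
    rw [zero_mul] at this
    exact this.eventually (gt_mem_nhds hr)
  -- In the direction `v` the slope of `Q` at `u` is `f p`. It is at most the slope of `V`, which
  -- `hrs` bounds by `s`; this contradicts `s < f p`.
  have hle : f p ≤ s := by
    refine le_of_tendsto hlim ?_
    filter_upwards [hev1.filter_mono nhdsWithin_le_nhds, hev2.filter_mono nhdsWithin_le_nhds,
      self_mem_nhdsWithin] with t h1 h2 (ht : 0 < t)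
    have h3 := hLip.sub_le_of_fderiv_le hrs ht.le h2
    simp only [zero_add, zero_smul, add_zero, smul_eq_mul, hQu]
    rw [inv_mul_le_iff₀ ht]
    linarith
  linarith

/-! ### The drift inequality for the envelope -/

theorem rpow_growth {a C₁ C₂ v r : ℝ} (ha : 0 < a) (hC₁ : 0 ≤ C₁) (hr : 0 ≤ r)
    (h₁ : C₁ * r ^ a ≤ v) (h₂ : v ≤ C₂ * r ^ a) (hC₂ : 0 ≤ C₂) :
    C₁ ^ (2 / a) * r ^ 2 ≤ v ^ (2 / a) ∧ v ^ (2 / a) ≤ C₂ ^ (2 / a) * r ^ 2 := by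
  have hra : (r ^ a) ^ (2 / a) = r ^ 2 := by
    rw [← Real.rpow_mul hr, mul_div_cancel₀ _ ha.ne', Real.rpow_two]
  have hra0 : 0 ≤ r ^ a := Real.rpow_nonneg hr a
  have hv : 0 ≤ v := (mul_nonneg hC₁ hra0).trans h₁
  constructor
  · rw [← hra, ← Real.mul_rpow hC₁ hra0]
    exact Real.rpow_le_rpow (mul_nonneg hC₁ hra0) h₁ (by positivity)
  · rw [← hra, ← Real.mul_rpow hC₂ hra0]
    exact Real.rpow_le_rpow hv h₂ (by positivity)

/-- The sign of `2 / a - 1` decides whether the upper or the lower growth bound is used; the maximum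
covers both cases. -/
theorem rpow_growth_exponent {a C₁ C₂ v r : ℝ} (ha : 0 < a) (hC₁ : 0 < C₁) (hC₂ : 0 < C₂)
    (hr : 0 < r) (h₁ : C₁ * r ^ a ≤ v) (h₂ : v ≤ C₂ * r ^ a) :
    v ^ (2 / a - 1) ≤ max (C₁ ^ (2 / a - 1)) (C₂ ^ (2 / a - 1)) * r ^ (2 - a) := by
  have hra : (r ^ a) ^ (2 / a - 1) = r ^ (2 - a) := by
    rw [← Real.rpow_mul hr.le]
    congr 1
    field_simp
  have hra0 : 0 < r ^ a := Real.rpow_pos_of_pos hr a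
  have hv : 0 < v := (mul_pos hC₁ hra0).trans_le h₁
  rcases le_total 0 (2 / a - 1) with he | he
  · calc v ^ (2 / a - 1) ≤ (C₂ * r ^ a) ^ (2 / a - 1) := Real.rpow_le_rpow hv.le h₂ he
      _ = C₂ ^ (2 / a - 1) * r ^ (2 - a) := by rw [Real.mul_rpow hC₂.le hra0.le, hra]
      _ ≤ _ := by gcongr; exact le_max_right _ _
  · calc v ^ (2 / a - 1) ≤ (C₁ * r ^ a) ^ (2 / a - 1) :=
          Real.rpow_le_rpow_of_nonpos (by positivity) h₁ he
      _ = C₁ ^ (2 / a - 1) * r ^ (2 - a) := by rw [Real.mul_rpow hC₁.le hra0.le, hra]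
      _ ≤ _ := by gcongr; exact le_max_left _ _

/-- If the minimizer in the Moreau envelope is the equilibrium, so is the base point. -/
theorem eq_of_moreauEnvelope_eq_of_eq_zero {d : ℕ} {R : EuclideanSpace ℝ (Fin d) → ℝ}
    (hR : ∀ x, 0 ≤ R x) {xs x : EuclideanSpace ℝ (Fin d)} {c₂ μ : ℝ} (hc₂ : 0 < c₂)
    (hR₂ : ∀ x, R x ≤ c₂ * ‖x - xs‖ ^ 2) (hμ : 0 < μ)
    (hu : moreauEnvelope R μ x = R xs + ‖x - xs‖ ^ 2 / (2 * μ)) : x = xs := by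
  by_contra hne
  have hρ : 0 < ‖x - xs‖ ^ 2 := by
    have := norm_pos_iff.mpr (sub_ne_zero.mpr hne)
    positivity
  -- This `t` minimizes `c₂ t² + (1 - t)² / (2μ)`. Moving from `xs` towards `x` gains to first order
  -- in `t` and costs only to second order, so `xs` cannot be the minimizer unless `x = xs`.
  set t : ℝ := 1 / (2 * μ * c₂ + 1) with ht
  have hle := moreauEnvelope_le hR hμ x (xs + t • (x - xs))
  have h1 := hR₂ (xs + t • (x - xs))
  have h2 : ‖xs + t • (x - xs) - xs‖ ^ 2 = t ^ 2 * ‖x - xs‖ ^ 2 := by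
    rw [add_sub_cancel_left, norm_smul, mul_pow, Real.norm_eq_abs, sq_abs]
  have h3 : ‖x - (xs + t • (x - xs))‖ ^ 2 = (1 - t) ^ 2 * ‖x - xs‖ ^ 2 := by
    rw [show x - (xs + t • (x - xs)) = (1 - t) • (x - xs) by module, norm_smul, mul_pow,
      Real.norm_eq_abs, sq_abs]
  rw [h2] at h1
  rw [h3, hu] at hle
  have h4 := hR xs
  have h5 : c₂ * (t ^ 2 * ‖x - xs‖ ^ 2) + (1 - t) ^ 2 * ‖x - xs‖ ^ 2 / (2 * μ)
      - ‖x - xs‖ ^ 2 / (2 * μ) = - (t * ‖x - xs‖ ^ 2 / (2 * μ)) := by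
    rw [ht]
    field_simp
    ring
  have h6 : 0 < t * ‖x - xs‖ ^ 2 / (2 * μ) := by positivity
  linarith

/-- A proximal subgradient of `V ^ (2 / a)` at a point where `V` is positive, rescaled by the chain
rule, lies in Clarke's generalized gradient of `V`. -/
theorem smul_prox_mem_clarkeGradient {d : ℕ} {V : EuclideanSpace ℝ (Fin d) → ℝ} {a μ : ℝ}
    (ha : 0 < a) (hV : LocallyLipschitz V) (hV0 : ∀ x, 0 ≤ V x) (hμ : 0 < μ)
    {x u : EuclideanSpace ℝ (Fin d)} (hVu : 0 < V u)
    (hu : moreauEnvelope (fun z => V z ^ (2 / a)) μ x = V u ^ (2 / a) + ‖x - u‖ ^ 2 / (2 * μ)) :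
    (a / 2 * (V u / V u ^ (2 / a))) • μ⁻¹ • (x - u) ∈ clarkeGradient V u := by
  have hinv : ∀ z, (V z ^ (2 / a)) ^ (a / 2) = V z := fun z => by
    rw [← Real.rpow_mul (hV0 z), div_mul_div_cancel₀ ha.ne', div_self two_ne_zero, Real.rpow_one]
  have hRu : 0 < V u ^ (2 / a) := Real.rpow_pos_of_pos hVu _
  -- Minimality of `u` says that this concave paraboloid supports `V ^ (2 / a)` from below at `u`.
  -- Its power `a / 2` then supports `V`; positivity at `u` makes the power differentiable and
  -- monotone nearby.
  set q : EuclideanSpace ℝ (Fin d) → ℝ :=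
    fun z => V u ^ (2 / a) + ‖x - u‖ ^ 2 / (2 * μ) - ‖z - x‖ ^ 2 / (2 * μ) with hq
  have hqu : q u = V u ^ (2 / a) := by simp [hq, norm_sub_rev]
  have hqd : HasFDerivAt q (InnerProductSpace.toDual ℝ _ (μ⁻¹ • (x - u))) u := by
    have h1 : HasFDerivAt (fun z : EuclideanSpace ℝ (Fin d) => z - x)
      (ContinuousLinearMap.id ℝ _) u := (hasFDerivAt_id u).sub_const x
    have h2 := ((h1.norm_sq).mul_const (2 * μ)⁻¹).const_sub
      (V u ^ (2 / a) + ‖x - u‖ ^ 2 / (2 * μ))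
    refine h2.congr_fderiv ?_
    ext v
    simp only [neg_apply, smul_apply,
      ContinuousLinearMap.comp_apply, ContinuousLinearMap.id_apply, innerSL_apply_apply,
      InnerProductSpace.toDual_apply_apply, real_inner_smul_left, smul_eq_mul, inner_sub_left]
    field_simp
    simp
    ring
  have hQd := hqd.rpow_const (p := a / 2) (Or.inl (by rw [hqu]; exact hRu.ne'))
  refine mem_clarkeGradient_of_hasGradientAt hV (Q := fun z => q z ^ (a / 2)) ?_ ?_ ?_
  · rw [hasGradientAt_iff_hasFDerivAt]
    refine hQd.congr_fderiv ?_
    rw [map_smul (InnerProductSpace.toDual ℝ (EuclideanSpace ℝ (Fin d)))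
      (a / 2 * (V u / V u ^ (2 / a)))]
    congr 2
    rw [hqu, Real.rpow_sub_one hRu.ne', hinv]
  · simp only [hqu, hinv]
  · have hpos : ∀ᶠ z in 𝓝 u, 0 < q z :=
      hqd.continuousAt.eventually (lt_mem_nhds (by rw [hqu]; exact hRu))
    filter_upwards [hpos] with z hz
    have hle := moreauEnvelope_le (R := fun z => V z ^ (2 / a))
      (fun z => Real.rpow_nonneg (hV0 z) _) hμ x z
    rw [hu] at hle
    calc q z ^ (a / 2) ≤ (V z ^ (2 / a)) ^ (a / 2) := by
          refine Real.rpow_le_rpow hz.le ?_ (by positivity)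
          simp only [hq, norm_sub_rev z x]
          linarith
      _ = V z := hinv z

theorem gradientConst_pos {a G C₁ C₂ : ℝ} (ha : 0 < a) (hG : 0 < G) (hC₁ : 0 < C₁) :
    0 < gradientConst a G C₁ C₂ := by
  have : 0 < max (C₁ ^ (2 / a - 1)) (C₂ ^ (2 / a - 1)) :=
    lt_max_of_lt_left (Real.rpow_pos_of_pos hC₁ _)
  unfold gradientConst
  positivity

/-- The drift inequality for the Moreau envelope, for the gradient supplied by a proximal point. -/
theorem inner_prox_le_driftConst {d : ℕ}
    {F : EuclideanSpace ℝ (Fin d) → EuclideanSpace ℝ (Fin d)} {xs : EuclideanSpace ℝ (Fin d)}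
    {V : EuclideanSpace ℝ (Fin d) → ℝ} {a γ C G C₁ C₂ μ : ℝ}
    (ha : 0 < a) (hγ : 0 < γ) (hC : 0 < C) (hG : 0 < G) (hC₁ : 0 < C₁) (hC₂ : 0 < C₂)
    (hFxs : F xs = 0) (hF : ∀ x y, ‖F x - F y‖ ≤ C * ‖x - y‖) (hV : LocallyLipschitz V)
    (hdrift : ∀ x, ∀ g ∈ clarkeGradient V x, inner ℝ g (F x) ≤ -γ * V x)
    (hgrowth : ∀ x, C₁ * ‖x - xs‖ ^ a ≤ V x ∧ V x ≤ C₂ * ‖x - xs‖ ^ a)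
    (hgrad : ∀ x, ∀ g ∈ clarkeGradient V x, ‖g‖ ≤ G * ‖x - xs‖ ^ (a - 1))
    (hμ : 0 < μ) (hpos : 0 < driftConst a γ C G C₁ C₂ μ) {x u : EuclideanSpace ℝ (Fin d)}
    (hu : moreauEnvelope (fun z => V z ^ (2 / a)) μ x = V u ^ (2 / a) + ‖x - u‖ ^ 2 / (2 * μ)) :
    inner ℝ (μ⁻¹ • (x - u)) (F x)
      ≤ -driftConst a γ C G C₁ C₂ μ * moreauEnvelope (fun z => V z ^ (2 / a)) μ x := by
  have hV0 : ∀ x, 0 ≤ V x := fun x => le_trans (by positivity) (hgrowth x).1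
  have hR0 : ∀ x, 0 ≤ V x ^ (2 / a) := fun x => Real.rpow_nonneg (hV0 x) _
  have hR := fun x => rpow_growth ha hC₁.le (norm_nonneg _) (hgrowth x).1 (hgrowth x).2 hC₂.le
  have hc₂ : 0 < C₂ ^ (2 / a) := Real.rpow_pos_of_pos hC₂ _
  have hMle := (moreauEnvelope_le_self hR0 hμ x).trans (hR x).2
  have hGM := gradientConst_pos (C₂ := C₂) ha hG hC₁
  unfold driftConst at hpos ⊢
  set GM := gradientConst a G C₁ C₂ with hGMdef
  set M := moreauEnvelope (fun z => V z ^ (2 / a)) μ with hM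
  set b := 2 * γ * C₁ ^ (2 / a) / (a * (1 + μ * GM) ^ 2) - μ * C * GM ^ 2 with hb
  rw [Real.rpow_neg hC₂.le] at hpos ⊢
  have hbpos : 0 < b := pos_of_mul_pos_left hpos (inv_nonneg.2 hc₂.le)
  have hdecay : b * (C₂ ^ (2 / a))⁻¹ * M x ≤ b * ‖x - xs‖ ^ 2 := by
    rw [mul_assoc]
    refine mul_le_mul_of_nonneg_left ?_ hbpos.le
    rwa [inv_mul_le_iff₀ hc₂]
  suffices h : inner ℝ (μ⁻¹ • (x - u)) (F x) ≤ -(b * ‖x - xs‖ ^ 2) by linarith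
  -- At `u = xs` the value `V u` vanishes and the chain rule is unavailable, but then `x = xs` and
  -- `F x = 0`.
  by_cases hux : u = xs
  · subst hux
    have hx := eq_of_moreauEnvelope_eq_of_eq_zero hR0 hc₂ (fun x => (hR x).2) hμ hu
    simp [hx]
  set r := ‖u - xs‖ with hr
  have hrpos : 0 < r := norm_pos_iff.mpr (sub_ne_zero.mpr hux)
  have hVu : 0 < V u := lt_of_lt_of_le (by positivity) (hgrowth u).1
  have hRu : 0 < V u ^ (2 / a) := Real.rpow_pos_of_pos hVu _
  have hp := smul_prox_mem_clarkeGradient ha hV hV0 hμ hVu hu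
  set g := μ⁻¹ • (x - u) with hg
  have hxu : x - u = μ • g := by rw [hg, smul_inv_smul₀ hμ.ne']
  have hkpos : 0 < a / 2 * (V u / V u ^ (2 / a)) := by positivity
  have h1 : inner ℝ g (F u) ≤ -(2 * γ / a * V u ^ (2 / a)) := by
    have := hdrift u _ hp
    rw [real_inner_smul_left, ← le_div_iff₀' hkpos] at this
    refine this.trans (le_of_eq ?_)
    field_simp
  have h2 : ‖g‖ ≤ GM * r := by
    have := hgrad u _ hp
    rw [norm_smul, Real.norm_of_nonneg hkpos.le, ← le_div_iff₀' hkpos] at this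
    refine this.trans ?_
    have h3 := rpow_growth_exponent ha hC₁ hC₂ hrpos (hgrowth u).1 (hgrowth u).2
    calc G * r ^ (a - 1) / (a / 2 * (V u / V u ^ (2 / a)))
        = 2 / a * G * r ^ (a - 1) * V u ^ (2 / a - 1) := by
          rw [Real.rpow_sub_one hVu.ne']
          field_simp
      _ ≤ 2 / a * G * r ^ (a - 1) *
          (max (C₁ ^ (2 / a - 1)) (C₂ ^ (2 / a - 1)) * r ^ (2 - a)) := by gcongr
      _ = GM * (r ^ (a - 1) * r ^ (2 - a)) := by rw [hGMdef, gradientConst]; ring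
      _ = GM * r := by
          rw [← Real.rpow_add hrpos, show a - 1 + (2 - a) = 1 by ring, Real.rpow_one]
  -- Passing from `F u` to `F x` costs `‖g‖ * C * ‖x - u‖`, and `x - u = μ • g`.
  have h3 : inner ℝ g (F x) ≤ -(2 * γ / a * V u ^ (2 / a)) + μ * C * GM ^ 2 * r ^ 2 := by
    have e : F x = F u + (F x - F u) := by abel
    rw [e, inner_add_right]
    have h4 : inner ℝ g (F x - F u) ≤ ‖g‖ * (C * (μ * ‖g‖)) := by
      refine (real_inner_le_norm _ _).trans ?_
      gcongr
      refine (hF x u).trans (le_of_eq ?_)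
      rw [hxu, norm_smul, Real.norm_of_nonneg hμ.le]
    have h5 : ‖g‖ ^ 2 ≤ (GM * r) ^ 2 := by gcongr
    have h6 := mul_le_mul_of_nonneg_left h5 (mul_pos hμ hC).le
    linarith
  have h4 : ‖x - xs‖ ≤ (1 + μ * GM) * r := by
    have : x - xs = (u - xs) + μ • g := by rw [← hxu]; abel
    rw [this]
    refine (norm_add_le _ _).trans ?_
    rw [norm_smul, Real.norm_of_nonneg hμ.le]
    have := mul_le_mul_of_nonneg_left h2 hμ.le
    linarith
  have h5 : ‖x - xs‖ ^ 2 ≤ (1 + μ * GM) ^ 2 * r ^ 2 := by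
    rw [← mul_pow]
    gcongr
  have hk : 0 < 2 * γ / a * C₁ ^ (2 / a) := by positivity
  have h6 : 2 * γ / a * C₁ ^ (2 / a) * r ^ 2 ≤ 2 * γ / a * V u ^ (2 / a) := by
    rw [mul_assoc]
    exact mul_le_mul_of_nonneg_left (hR u).1 (by positivity)
  have hb' : b = 2 * γ / a * C₁ ^ (2 / a) / (1 + μ * GM) ^ 2 - μ * C * GM ^ 2 := by
    rw [hb]
    congr 1
    field_simp
  have hk2 : 0 < μ * C * GM ^ 2 := by positivity
  have hone : 1 ≤ (1 + μ * GM) ^ 2 := by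
    have : 0 < μ * GM := by positivity
    nlinarith
  -- The negative term needs `r` bounded below by `‖x - xs‖`, the positive one needs it bounded
  -- above. For `r ≤ ‖x - xs‖` both bounds are at hand, the lower one with the factor `1 + μ * GM`.
  -- For `r ≥ ‖x - xs‖` the net coefficient of `-r²` is at least `b > 0`, and `r²` is simply
  -- decreased to `‖x - xs‖²`.
  rcases le_total r ‖x - xs‖ with hle | hle
  · have h7 : r ^ 2 ≤ ‖x - xs‖ ^ 2 := by gcongr
    have h8 : 2 * γ / a * C₁ ^ (2 / a) / (1 + μ * GM) ^ 2 * ‖x - xs‖ ^ 2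
        ≤ 2 * γ / a * C₁ ^ (2 / a) * r ^ 2 := by
      rw [div_mul_eq_mul_div, div_le_iff₀ (by positivity)]
      have := mul_le_mul_of_nonneg_left h5 hk.le
      linarith
    have h9 := mul_le_mul_of_nonneg_left h7 hk2.le
    rw [hb', sub_mul]
    linarith
  · have h7 : ‖x - xs‖ ^ 2 ≤ r ^ 2 := by gcongr
    have h8 : b ≤ 2 * γ / a * C₁ ^ (2 / a) - μ * C * GM ^ 2 := by
      rw [hb']
      have := div_le_self hk.le hone
      linarith
    have h9 := mul_le_mul_of_nonneg_left h7 hbpos.le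
    have h10 := mul_le_mul_of_nonneg_right h8 (sq_nonneg r)
    rw [sub_mul] at h10
    linarith

/-- A drift inequality that holds for all proximal gradients holds on Clarke's generalized gradient
of the Moreau envelope. -/
theorem inner_le_of_mem_clarkeGradient_moreauEnvelope {d : ℕ}
    {F : EuclideanSpace ℝ (Fin d) → EuclideanSpace ℝ (Fin d)} (hF : Continuous F)
    {R : EuclideanSpace ℝ (Fin d) → ℝ} (hR : ∀ x, 0 ≤ R x) (hRc : Continuous R) {μ γ : ℝ}
    (hμ : 0 < μ)
    (h : ∀ x u, moreauEnvelope R μ x = R u + ‖x - u‖ ^ 2 / (2 * μ) →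
      inner ℝ (μ⁻¹ • (x - u)) (F x) ≤ -γ * moreauEnvelope R μ x)
    {y g : EuclideanSpace ℝ (Fin d)} (hg : g ∈ clarkeGradient (moreauEnvelope R μ) y) :
    inner ℝ g (F y) ≤ -γ * moreauEnvelope R μ y := by
  -- The condition on `g` defines a closed half-space, so it suffices to check limits of gradients,
  -- and each such gradient is the one given by a proximal point.
  set H : Set (EuclideanSpace ℝ (Fin d)) := {g | inner ℝ g (F y) ≤ -γ * moreauEnvelope R μ y}
  have hHc : IsClosed H := isClosed_le (by fun_prop) continuous_const
  have hHconv : Convex ℝ H := by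
    refine convex_halfSpace_le ⟨fun v w => inner_add_left _ _ _, fun c v => ?_⟩ _
    rw [real_inner_smul_left, smul_eq_mul]
  refine closure_minimal (convexHull_min ?_ hHconv) hHc hg
  rintro p ⟨z, hzd, hz, hp⟩
  have hMc := continuous_moreauEnvelope hR hRc hμ
  refine le_of_tendsto_of_tendsto (hp.inner ((hF.tendsto y).comp hz))
    (((hMc.tendsto y).comp hz).const_mul (-γ)) (Eventually.of_forall fun i => ?_)
  obtain ⟨u, hu⟩ := exists_moreauEnvelope_eq hR hRc hμ (z i)
  have := h (z i) u hu
  rwa [← gradient_moreauEnvelope hR hμ hu (hzd i)] at this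

/-! ### One step of the recursion in mean -/

theorem MeasureTheory.MemLp.integrable_inner_mul {Ω E : Type*} [MeasurableSpace Ω]
    [NormedAddCommGroup E] [InnerProductSpace ℝ E] {P : Measure Ω} {X Y : Ω → E}
    (hX : MemLp X 2 P) (hY : MemLp Y 2 P) : Integrable (fun ω => inner ℝ (X ω) (Y ω)) P := by
  refine (hX.norm.integrable_mul hY.norm).mono'
    (hX.aestronglyMeasurable.inner hY.aestronglyMeasurable) (Eventually.of_forall fun ω => ?_)
  exact norm_inner_le_norm _ _

theorem integral_inner_eq_zero_of_condExp_eq_zero {Ω E : Type*} {m mΩ : MeasurableSpace Ω}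
    [NormedAddCommGroup E] [InnerProductSpace ℝ E] [CompleteSpace E] {P : Measure Ω}
    [IsFiniteMeasure P] (hm : m ≤ mΩ) {X W : Ω → E} (hXm : StronglyMeasurable[m] X)
    (hX : MemLp X 2 P) (hW : MemLp W 2 P) (hmean : P[W | m] =ᵐ[P] 0) :
    ∫ ω, inner ℝ (X ω) (W ω) ∂P = 0 := by
  have h : P[fun ω => inner ℝ (X ω) (W ω) | m] =ᵐ[P] fun ω => inner ℝ (X ω) (P[W | m] ω) :=
    condExp_bilin_of_stronglyMeasurable_left (μ := P) (innerSL ℝ) hXm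
      (hX.integrable_inner_mul hW) (hW.integrable one_le_two)
  rw [← integral_condExp (μ := P) hm (f := fun ω => inner ℝ (X ω) (W ω)), integral_eq_zero_of_ae]
  filter_upwards [h, hmean] with ω h1 h3
  simp [h1, h3]

/-- Conditional Jensen: `Y` is the conditional expectation of `Y + β • W`. -/
theorem integral_concave_add_smul_le {Ω E : Type*} {m mΩ : MeasurableSpace Ω}
    [NormedAddCommGroup E] [NormedSpace ℝ E] [FiniteDimensional ℝ E] {P : Measure Ω}
    [IsFiniteMeasure P] (hm : m ≤ mΩ) {φ : E → ℝ} (hφ : ConcaveOn ℝ univ φ) {Y W : Ω → E} {β : ℝ}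
    (hYm : StronglyMeasurable[m] Y) (hY : Integrable Y P) (hW : Integrable W P)
    (hmean : P[W | m] =ᵐ[P] 0) (hφY : Integrable (fun ω => φ (Y ω)) P)
    (hφYW : Integrable (fun ω => φ (Y ω + β • W ω)) P) :
    ∫ ω, φ (Y ω + β • W ω) ∂P ≤ ∫ ω, φ (Y ω) ∂P := by
  have : CompleteSpace E := FiniteDimensional.complete ℝ E
  have hJ := hφ.condExp_map_le_of_finiteDimensional (μ := P) hm (f := Y + β • W)
    (hY.add (hW.smul β)) hφYW
  have hE : P[Y + β • W | m] =ᵐ[P] Y := by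
    filter_upwards [condExp_add hY (hW.smul β) m, condExp_smul (μ := P) β W m, hmean]
      with ω h1 h2 h3
    rw [h1, Pi.add_apply, h2, Pi.smul_apply, h3, condExp_of_stronglyMeasurable hm hYm hY]
    simp
  have h2 := integral_condExp (μ := P) hm (f := φ ∘ (Y + β • W))
  calc ∫ ω, φ (Y ω + β • W ω) ∂P = ∫ ω, (P[φ ∘ (Y + β • W) | m]) ω ∂P := h2.symm
    _ ≤ ∫ ω, φ (Y ω) ∂P := by
      refine integral_mono_ae integrable_condExp hφY ?_
      filter_upwards [hJ, hE] with ω h3 h4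
      rw [Function.comp_apply, h4] at h3
      exact h3

theorem integrable_moreauEnvelope_comp {Ω : Type*} [MeasurableSpace Ω] {P : Measure Ω}
    [IsFiniteMeasure P] {d : ℕ} {R : EuclideanSpace ℝ (Fin d) → ℝ} (hR : ∀ x, 0 ≤ R x)
    (hRc : Continuous R) {xs : EuclideanSpace ℝ (Fin d)} {c₂ μ : ℝ}
    (hR₂ : ∀ x, R x ≤ c₂ * ‖x - xs‖ ^ 2) (hμ : 0 < μ) {X : Ω → EuclideanSpace ℝ (Fin d)}
    (hX : MemLp X 2 P) : Integrable (fun ω => moreauEnvelope R μ (X ω)) P := by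
  have h1 : Integrable (fun ω => c₂ * ‖X ω - xs‖ ^ 2) P :=
    ((hX.sub (memLp_const xs)).integrable_norm_pow two_ne_zero).const_mul c₂
  refine h1.mono' ((continuous_moreauEnvelope hR hRc hμ).comp_aestronglyMeasurable
    hX.aestronglyMeasurable) (Eventually.of_forall fun ω => ?_)
  rw [Real.norm_of_nonneg (moreauEnvelope_nonneg hR hμ _)]
  exact (moreauEnvelope_le_self hR hμ _).trans (hR₂ _)

/-- Centered noise raises the mean of the Moreau envelope by at most its scaled variance. -/
theorem integral_moreauEnvelope_add_smul_le {Ω : Type*} {m mΩ : MeasurableSpace Ω}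
    {P : Measure Ω} [IsFiniteMeasure P] (hm : m ≤ mΩ) {d : ℕ}
    {R : EuclideanSpace ℝ (Fin d) → ℝ} (hR : ∀ x, 0 ≤ R x)
    (hRc : Continuous R) {xs : EuclideanSpace ℝ (Fin d)} {c₂ μ : ℝ}
    (hR₂ : ∀ x, R x ≤ c₂ * ‖x - xs‖ ^ 2) (hμ : 0 < μ) {Y W : Ω → EuclideanSpace ℝ (Fin d)}
    (hYm : StronglyMeasurable[m] Y) (hY : MemLp Y 2 P) (hW : MemLp W 2 P)
    (hmean : P[W | m] =ᵐ[P] 0) (β : ℝ) :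
    ∫ ω, moreauEnvelope R μ (Y ω + β • W ω) ∂P
      ≤ ∫ ω, moreauEnvelope R μ (Y ω) ∂P + β ^ 2 * (∫ ω, ‖W ω‖ ^ 2 ∂P) / (2 * μ) := by
  have hYW : MemLp (fun ω => Y ω + β • W ω) 2 P := hY.add (hW.const_smul β)
  have i1 := integrable_moreauEnvelope_comp hR hRc hR₂ hμ hY
  have i2 := integrable_moreauEnvelope_comp hR hRc hR₂ hμ hYW
  have n1 : Integrable (fun ω => ‖Y ω‖ ^ 2 / (2 * μ)) P :=
    (hY.integrable_norm_pow two_ne_zero).div_const _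
  have n2 : Integrable (fun ω => ‖Y ω + β • W ω‖ ^ 2 / (2 * μ)) P :=
    (hYW.integrable_norm_pow two_ne_zero).div_const _
  have n3 : Integrable (fun ω => ‖W ω‖ ^ 2) P := hW.integrable_norm_pow two_ne_zero
  have hJ := integral_concave_add_smul_le hm (concaveOn_moreauEnvelope_sub hR hRc hμ) (β := β) hYm
    (hY.integrable one_le_two) (hW.integrable one_le_two) hmean (i1.sub n1) (i2.sub n2)
  rw [integral_sub i2 n2, integral_sub i1 n1] at hJ
  have hn : ∫ ω, ‖Y ω + β • W ω‖ ^ 2 / (2 * μ) ∂P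
      = ∫ ω, ‖Y ω‖ ^ 2 / (2 * μ) ∂P + β ^ 2 * (∫ ω, ‖W ω‖ ^ 2 ∂P) / (2 * μ) := by
    have e : ∀ ω, ‖Y ω + β • W ω‖ ^ 2 / (2 * μ) = ‖Y ω‖ ^ 2 / (2 * μ)
        + (β / μ * inner ℝ (Y ω) (W ω) + β ^ 2 / (2 * μ) * ‖W ω‖ ^ 2) := by
      intro ω
      rw [norm_add_sq_real, real_inner_smul_right, norm_smul, mul_pow, Real.norm_eq_abs, sq_abs]
      field_simp
      ring
    simp only [e]
    have i3 := (hY.integrable_inner_mul hW).const_mul (β / μ)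
    have i4 := n3.const_mul (β ^ 2 / (2 * μ))
    have i5 : Integrable (fun ω => β / μ * inner ℝ (Y ω) (W ω)
      + β ^ 2 / (2 * μ) * ‖W ω‖ ^ 2) P := i3.add i4
    rw [integral_add n1 i5, integral_add i3 i4,
      integral_const_mul, integral_const_mul,
      integral_inner_eq_zero_of_condExp_eq_zero hm hYm hY hW hmean]
    ring
  linarith

/-- One step of the recursion in mean. -/
theorem integral_moreauEnvelope_step_le {Ω : Type*} {m mΩ : MeasurableSpace Ω}
    {P : Measure Ω} [IsProbabilityMeasure P] (hm : m ≤ mΩ) {d : ℕ}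
    {F : EuclideanSpace ℝ (Fin d) → EuclideanSpace ℝ (Fin d)} {C : ℝ} (hC : 0 < C)
    {xs : EuclideanSpace ℝ (Fin d)} (hFxs : F xs = 0) (hFC : Continuous F)
    (hF : ∀ x y, ‖F x - F y‖ ≤ C * ‖x - y‖)
    {R : EuclideanSpace ℝ (Fin d) → ℝ} (hR : ∀ x, 0 ≤ R x)
    (hRc : Continuous R) {c₁ c₂ μ γ A B β : ℝ} (hc₁ : 0 < c₁)
    (hR₁ : ∀ x, c₁ * ‖x - xs‖ ^ 2 ≤ R x)
    (hR₂ : ∀ x, R x ≤ c₂ * ‖x - xs‖ ^ 2) (hμ : 0 < μ) (hA : 0 ≤ A) (hB : 0 ≤ B)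
    (hdrift : ∀ x u, moreauEnvelope R μ x = R u + ‖x - u‖ ^ 2 / (2 * μ) →
      inner ℝ (μ⁻¹ • (x - u)) (F x) ≤ -γ * moreauEnvelope R μ x)
    (hβ : 0 ≤ β) (hβle : β * (2 * (C ^ 2 + 2 * B) * (1 / c₁ + 2 * μ)) ≤ γ * μ)
    {X W : Ω → EuclideanSpace ℝ (Fin d)}
    (hXm : StronglyMeasurable[m] X) (hX : MemLp X 2 P) (hFX : MemLp (fun ω => F (X ω)) 2 P)
    (hW : MemLp W 2 P) (hmean : P[W | m] =ᵐ[P] 0)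
    (hvar : P[fun ω => ‖W ω‖ ^ 2 | m] ≤ᵐ[P] fun ω => A + B * ‖X ω‖ ^ 2) :
    ∫ ω, moreauEnvelope R μ (X ω + β • (F (X ω) + W ω)) ∂P
      ≤ (1 - β * γ / 2) * ∫ ω, moreauEnvelope R μ (X ω) ∂P
        + β ^ 2 * ((A + 2 * B * ‖xs‖ ^ 2) / μ) := by
  have hY : MemLp (fun ω => X ω + β • F (X ω)) 2 P := hX.add (hFX.const_smul β)
  have hYm : StronglyMeasurable[m] (fun ω => X ω + β • F (X ω)) :=
    hXm.add ((hFC.comp_stronglyMeasurable hXm).const_smul β)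
  have h1 := integral_moreauEnvelope_add_smul_le hm hR hRc hR₂ hμ hYm hY hW hmean β
  have e : ∀ ω, X ω + β • (F (X ω) + W ω) = X ω + β • F (X ω) + β • W ω := fun ω => by
    rw [smul_add, add_assoc]
  simp only [e]
  have iM := integrable_moreauEnvelope_comp hR hRc hR₂ hμ hX
  have iMY := integrable_moreauEnvelope_comp hR hRc hR₂ hμ hY
  have iX : Integrable (fun ω => ‖X ω - xs‖ ^ 2) P :=
    (hX.sub (memLp_const xs)).integrable_norm_pow two_ne_zero
  have hρ : ∫ ω, ‖X ω - xs‖ ^ 2 ∂P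
      ≤ (1 / c₁ + 2 * μ) * ∫ ω, moreauEnvelope R μ (X ω) ∂P := by
    rw [← integral_const_mul]
    exact integral_mono iX (iM.const_mul _) fun ω =>
      sq_norm_sub_le_moreauEnvelope hc₁ hR₁ hμ (X ω)
  have hρ0 : 0 ≤ ∫ ω, ‖X ω - xs‖ ^ 2 ∂P := integral_nonneg fun ω => by positivity
  have hdet : ∫ ω, moreauEnvelope R μ (X ω + β • F (X ω)) ∂P
      ≤ (1 - β * γ) * ∫ ω, moreauEnvelope R μ (X ω) ∂P
        + β ^ 2 * C ^ 2 / (2 * μ) * ∫ ω, ‖X ω - xs‖ ^ 2 ∂P := by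
    rw [← integral_const_mul, ← integral_const_mul,
      ← integral_add (iM.const_mul _) (iX.const_mul _)]
    refine integral_mono iMY ((iM.const_mul _).add (iX.const_mul _)) fun ω => ?_
    -- The proximal point is chosen separately for each `ω` and does not appear in the resulting
    -- bound, so its measurability plays no role.
    obtain ⟨u, hu⟩ := exists_moreauEnvelope_eq hR hRc hμ (X ω)
    have h2 := moreauEnvelope_le_add_inner hR hμ hu (X ω + β • F (X ω))
    rw [add_sub_cancel_left, real_inner_smul_right, norm_smul, mul_pow, Real.norm_eq_abs,
      sq_abs] at h2
    have h3 := mul_le_mul_of_nonneg_left (hdrift _ _ hu) hβ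
    have h4 : ‖F (X ω)‖ ≤ C * ‖X ω - xs‖ := by simpa [hFxs] using hF (X ω) xs
    have h5 : ‖F (X ω)‖ ^ 2 ≤ (C * ‖X ω - xs‖) ^ 2 := by gcongr
    have h6 : β ^ 2 * ‖F (X ω)‖ ^ 2 / (2 * μ) ≤ β ^ 2 * (C * ‖X ω - xs‖) ^ 2 / (2 * μ) := by
      gcongr
    have h7 : β ^ 2 * (C * ‖X ω - xs‖) ^ 2 / (2 * μ)
      = β ^ 2 * C ^ 2 / (2 * μ) * ‖X ω - xs‖ ^ 2 := by ring
    simp only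
    linarith
  -- Centering the variance bound at `xs` through `‖X‖² ≤ 2 ‖X - xs‖² + 2 ‖xs‖²` produces both
  -- factors `2 * B`.
  have hnoise : ∫ ω, ‖W ω‖ ^ 2 ∂P
      ≤ (A + 2 * B * ‖xs‖ ^ 2) + 2 * B * ∫ ω, ‖X ω - xs‖ ^ 2 ∂P := by
    rw [← integral_condExp (μ := P) hm (f := fun ω => ‖W ω‖ ^ 2)]
    calc _ ≤ ∫ ω, ((A + 2 * B * ‖xs‖ ^ 2) + 2 * B * ‖X ω - xs‖ ^ 2) ∂P := by
          refine integral_mono_ae integrable_condExp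
            ((integrable_const _).add (iX.const_mul _)) ?_
          filter_upwards [hvar] with ω h
          refine h.trans ?_
          have h2 : ‖X ω‖ ≤ ‖X ω - xs‖ + ‖xs‖ := by
            simpa using norm_add_le (X ω - xs) xs
          have h3 : ‖X ω‖ ^ 2 ≤ (‖X ω - xs‖ + ‖xs‖) ^ 2 := by gcongr
          have h4 := mul_le_mul_of_nonneg_left
            (h3.trans (add_sq_le (a := ‖X ω - xs‖) (b := ‖xs‖))) hB
          linarith
      _ = _ := by
          rw [integral_add (integrable_const _) (iX.const_mul _), integral_const_mul]
          simp
  have hM0 : 0 ≤ ∫ ω, moreauEnvelope R μ (X ω) ∂P :=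
    integral_nonneg fun ω => moreauEnvelope_nonneg hR hμ _
  set EM := ∫ ω, moreauEnvelope R μ (X ω) ∂P
  set Eρ := ∫ ω, ‖X ω - xs‖ ^ 2 ∂P
  set N := A + 2 * B * ‖xs‖ ^ 2
  have hN : 0 ≤ N := by positivity
  have h2 : β ^ 2 * (∫ ω, ‖W ω‖ ^ 2 ∂P) / (2 * μ) ≤ β ^ 2 * (N + 2 * B * Eρ) / (2 * μ) := by
    gcongr
  -- The step restriction absorbs the second order term. It even yields `β * γ / 4 * EM`, so a
  -- factor of two is given away, as it is in `h4` for the noise.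
  have h3 : β ^ 2 * (C ^ 2 + 2 * B) / (2 * μ) * Eρ ≤ β * γ / 2 * EM := by
    calc _ ≤ β ^ 2 * (C ^ 2 + 2 * B) / (2 * μ) * ((1 / c₁ + 2 * μ) * EM) := by gcongr
      _ = β * (β * (2 * (C ^ 2 + 2 * B) * (1 / c₁ + 2 * μ))) / (4 * μ) * EM := by ring
      _ ≤ β * (γ * μ) / (4 * μ) * EM := by gcongr
      _ = (β * γ / 2 * EM) / 2 := by field_simp; ring
      _ ≤ β * γ / 2 * EM := by
        have hc : 0 < 2 * (C ^ 2 + 2 * B) * (1 / c₁ + 2 * μ) := by positivity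
        have : 0 ≤ γ := by
          have : 0 ≤ γ * μ := (mul_nonneg hβ hc.le).trans hβle
          exact nonneg_of_mul_nonneg_left this hμ
        have : 0 ≤ β * γ / 2 * EM := by positivity
        linarith
  have h4 : β ^ 2 * N / (2 * μ) ≤ β ^ 2 * (N / μ) := by
    rw [← mul_div_assoc]
    gcongr
    linarith
  have h5 : β ^ 2 * (N + 2 * B * Eρ) / (2 * μ) + β ^ 2 * C ^ 2 / (2 * μ) * Eρ
    = β ^ 2 * N / (2 * μ) + β ^ 2 * (C ^ 2 + 2 * B) / (2 * μ) * Eρ := by ring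
  linarith

/-! ### Scalar recursions -/

/-- From `log y ≥ 1 - 1 / y` and `exp y ≥ 1 + y`. It makes `n ^ (-r)` a supersolution of the
homogeneous recursion with factor `1 - r / n`. -/
theorem one_sub_div_le_div_add_one_rpow {n r : ℝ} (hn : 0 < n) (hr : 0 ≤ r) :
    1 - r / n ≤ (n / (n + 1)) ^ r := by
  have h1 : 0 < n / (n + 1) := by positivity
  have h2 := Real.one_sub_inv_le_log_of_pos h1
  have h3 : 1 - (n / (n + 1))⁻¹ = -(1 / n) := by field_simp; ring
  rw [h3] at h2
  rw [Real.rpow_def_of_pos h1]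
  have h4 := mul_le_mul_of_nonneg_right h2 hr
  have h5 := Real.add_one_le_exp (Real.log (n / (n + 1)) * r)
  have h6 : -(1 / n) * r = -(r / n) := by ring
  linarith

theorem one_add_div_le_add_one_div_rpow {n r : ℝ} (hn : 0 < n) (hr : 0 ≤ r) :
    1 + r / (n + 1) ≤ ((n + 1) / n) ^ r := by
  have h1 : 0 < (n + 1) / n := by positivity
  have h2 := Real.one_sub_inv_le_log_of_pos h1
  have h3 : 1 - ((n + 1) / n)⁻¹ = 1 / (n + 1) := by field_simp; ring
  rw [h3] at h2
  rw [Real.rpow_def_of_pos h1]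
  have h4 := mul_le_mul_of_nonneg_right h2 hr
  have h5 := Real.add_one_le_exp (Real.log ((n + 1) / n) * r)
  have h6 : 1 / (n + 1) * r = r / (n + 1) := by ring
  linarith

/-- Comparison principle: `q k ≤ 1` keeps the multiplier nonnegative, so the recursion preserves
order. -/
theorem le_of_linear_recursion {u b q e : ℕ → ℝ} (hq : ∀ k, q k ≤ 1)
    (hu : ∀ k, u (k + 1) ≤ (1 - q k) * u k + e k) (h0 : u 0 ≤ b 0)
    (hb : ∀ k, (1 - q k) * b k + e k ≤ b (k + 1)) (k : ℕ) : u k ≤ b k := by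
  induction k with
  | zero => exact h0
  | succ k ih =>
    have := mul_le_mul_of_nonneg_left ih (sub_nonneg.2 (hq k))
    linarith [hu k, hb k]

/-- Variation of constants: `n ^ (-p)` is a homogeneous supersolution, and the increments of `τ`
must pay for the noise `e / n ^ 2`. Thus `τ n` has to dominate a multiple of the sum of `j ^ (p -
2)`, which is bounded, logarithmic or of order `n ^ (p - 1)` according as `p < 1`, `p = 1` or `p >
1`. -/
theorem harmonic_recursion_le {u : ℕ → ℝ} {K p e : ℝ} {τ : ℝ → ℝ} (hK : 1 ≤ K) (hp : 0 ≤ p)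
    (hpK : p ≤ K) (hu0 : 0 ≤ u 0)
    (hu : ∀ k : ℕ, u (k + 1) ≤ (1 - p / (k + K)) * u k + e / (k + K) ^ 2)
    (hτ0 : ∀ n, K ≤ n → 0 ≤ τ n)
    (hτ : ∀ n, K ≤ n → e / n ^ 2 ≤ (n + 1) ^ (-p) * (τ (n + 1) - τ n)) (k : ℕ) :
    u k ≤ u 0 * (K / (k + K)) ^ p + (k + K) ^ (-p) * τ (k + K) := by
  refine le_of_linear_recursion (q := fun k : ℕ => p / (k + K))
    (e := fun k : ℕ => e / (k + K) ^ 2)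
    (b := fun k : ℕ => u 0 * (K / (k + K)) ^ p + (k + K) ^ (-p) * τ (k + K))
    (fun k => ?_) hu ?_ (fun k => ?_) k
  · have : (0 : ℝ) ≤ k := k.cast_nonneg
    exact div_le_one_of_le₀ (by linarith) (by linarith)
  · have hK0 : 0 < K := by linarith
    have : 0 ≤ K ^ (-p) * τ K := mul_nonneg (by positivity) (hτ0 K le_rfl)
    simpa [div_self hK0.ne'] using this
  · have hk : (0 : ℝ) ≤ k := k.cast_nonneg
    have hKn : K ≤ k + K := by linarith
    push_cast
    rw [show (k : ℝ) + 1 + K = k + K + 1 by ring]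
    set n : ℝ := k + K with hn
    have hnpos : 0 < n := by linarith
    have hA := one_sub_div_le_div_add_one_rpow hnpos hp
    have h1 : (1 - p / n) * (K / n) ^ p ≤ (K / (n + 1)) ^ p := by
      calc _ ≤ (n / (n + 1)) ^ p * (K / n) ^ p := by gcongr
        _ = (K / (n + 1)) ^ p := by
          rw [← Real.mul_rpow (by positivity) (by positivity)]
          congr 1
          field_simp
    have h2 : (1 - p / n) * n ^ (-p) ≤ (n + 1) ^ (-p) := by
      calc _ ≤ (n / (n + 1)) ^ p * n ^ (-p) := by gcongr
        _ = (n + 1) ^ (-p) := by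
          rw [Real.div_rpow (by positivity) (by positivity), Real.rpow_neg hnpos.le,
            Real.rpow_neg (by positivity)]
          have : 0 < n ^ p := by positivity
          field_simp
    have h3 := mul_le_mul_of_nonneg_left h1 hu0
    have h4 := mul_le_mul_of_nonneg_right h2 (hτ0 n hKn)
    have h5 := hτ n hKn
    calc _ = u 0 * ((1 - p / n) * (K / n) ^ p) + (1 - p / n) * n ^ (-p) * τ n + e / n ^ 2 := by
          ring
      _ ≤ _ := by rw [mul_sub] at h5; linarith

theorem harmonic_recursion_le_of_lt_one {u : ℕ → ℝ} {K p e : ℝ} (hK : 1 ≤ K) (hp : 0 ≤ p)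
    (hpK : p ≤ K) (hu0 : 0 ≤ u 0) (he : 0 ≤ e)
    (hu : ∀ k : ℕ, u (k + 1) ≤ (1 - p / (k + K)) * u k + e / (k + K) ^ 2) (hp1 : p < 1) (k : ℕ) :
    u k ≤ u 0 * (K / (k + K)) ^ p + 4 * e / (1 - p) * (1 / (k + K) ^ p) := by
  have hp1' : 0 < 1 - p := by linarith
  have h := harmonic_recursion_le (τ := fun n => 4 * e / (1 - p) * (1 - n ^ (p - 1))) hK hp hpK
    hu0 hu ?_ ?_ k
  · refine h.trans ?_
    have hn : (0 : ℝ) < k + K := by positivity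
    have h1 : (4 * e / (1 - p)) * (1 - (k + K) ^ (p - 1)) ≤ 4 * e / (1 - p) := by
      refine mul_le_of_le_one_right (by positivity) ?_
      have : 0 ≤ (k + K) ^ (p - 1) := by positivity
      linarith
    rw [Real.rpow_neg hn.le, one_div, mul_comm (4 * e / (1 - p)) (((k : ℝ) + K) ^ p)⁻¹]
    gcongr
  · intro n hn
    have : n ^ (p - 1) ≤ 1 := Real.rpow_le_one_of_one_le_of_nonpos (by linarith) (by linarith)
    exact mul_nonneg (by positivity) (by linarith)
  · intro n hn
    have hn1 : 1 ≤ n := hK.trans hn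
    have hn0 : 0 < n := by linarith
    have hB := one_add_div_le_add_one_div_rpow hn0 hp1'.le
    have h1 : (n + 1) ^ (p - 1) * ((n + 1) / n) ^ (1 - p) = n ^ (p - 1) := by
      rw [Real.div_rpow (by positivity) hn0.le, ← neg_sub 1 p, Real.rpow_neg hn0.le,
        Real.rpow_neg (by positivity)]
      have : 0 < (n + 1) ^ (1 - p) := by positivity
      field_simp
    have h2 : (n + 1) ^ (p - 1) * (1 + (1 - p) / (n + 1)) ≤ n ^ (p - 1) := by
      rw [← h1]; gcongr
    have h3 : (n + 1) ^ (-p) * (n + 1) ^ (p - 1) = 1 / (n + 1) := by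
      rw [← Real.rpow_add (by positivity), show -p + (p - 1) = -1 by ring, Real.rpow_neg_one,
        one_div]
    -- The constant 4 comes from `n + 1 ≤ 2 * n`, valid since `n ≥ 1`.
    calc e / n ^ 2 ≤ 4 * e / (n + 1) ^ 2 := by
          rw [div_le_div_iff₀ (by positivity) (by positivity)]
          nlinarith [mul_nonneg he (by nlinarith : 0 ≤ 4 * n ^ 2 - (n + 1) ^ 2)]
      _ = 4 * e / (1 - p) * (1 / (n + 1) * ((1 - p) / (n + 1))) := by field_simp
      _ = (n + 1) ^ (-p) * (4 * e / (1 - p)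
            * ((n + 1) ^ (p - 1) * (1 + (1 - p) / (n + 1)) - (n + 1) ^ (p - 1))) := by
          rw [← h3]; ring
      _ ≤ (n + 1) ^ (-p) * (4 * e / (1 - p) * (n ^ (p - 1) - (n + 1) ^ (p - 1))) := by gcongr
      _ = _ := by ring

theorem harmonic_recursion_le_of_eq_one {u : ℕ → ℝ} {K p e : ℝ} (hK : 1 ≤ K)
    (hpK : p ≤ K) (hu0 : 0 ≤ u 0) (he : 0 ≤ e)
    (hu : ∀ k : ℕ, u (k + 1) ≤ (1 - p / (k + K)) * u k + e / (k + K) ^ 2) (hp1 : p = 1) (k : ℕ) :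
    u k ≤ u 0 * (K / (k + K)) ^ p + 4 * e * Real.log (k + K) / (k + K) := by
  have h := harmonic_recursion_le (τ := fun n => 4 * e * Real.log n) hK (by linarith) hpK
    hu0 hu ?_ ?_ k
  · refine h.trans (le_of_eq ?_)
    rw [hp1, Real.rpow_neg_one]
    ring
  · intro n hn
    exact mul_nonneg (by positivity) (Real.log_nonneg (hK.trans hn))
  · intro n hn
    have hn1 : 1 ≤ n := hK.trans hn
    have hn0 : 0 < n := by linarith
    have h1 : 1 / (n + 1) ≤ Real.log (n + 1) - Real.log n := by
      rw [← Real.log_div (by positivity) hn0.ne']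
      refine le_trans (le_of_eq ?_) (Real.one_sub_inv_le_log_of_pos (by positivity))
      field_simp
      ring
    rw [hp1, Real.rpow_neg_one, ← mul_sub]
    calc e / n ^ 2 ≤ 4 * e / (n + 1) ^ 2 := by
          rw [div_le_div_iff₀ (by positivity) (by positivity)]
          nlinarith [mul_nonneg he (by nlinarith : 0 ≤ 4 * n ^ 2 - (n + 1) ^ 2)]
      _ = (n + 1)⁻¹ * (4 * e * (1 / (n + 1))) := by field_simp
      _ ≤ _ := by gcongr

theorem harmonic_recursion_le_of_one_lt {u : ℕ → ℝ} {K p e : ℝ} (hK : 1 ≤ K)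
    (hpK : p ≤ K) (hu0 : 0 ≤ u 0) (he : 0 ≤ e)
    (hu : ∀ k : ℕ, u (k + 1) ≤ (1 - p / (k + K)) * u k + e / (k + K) ^ 2) (hp1 : 1 < p) (k : ℕ) :
    u k ≤ u 0 * (K / (k + K)) ^ p + 4 * e / (p - 1) * (1 / (k + K)) := by
  have hp1' : 0 < p - 1 := by linarith
  have h := harmonic_recursion_le (τ := fun n => 4 * e / (p - 1) * n ^ (p - 1)) hK (by linarith)
    hpK hu0 hu ?_ ?_ k
  · refine h.trans (le_of_eq ?_)
    have hn : (0 : ℝ) < k + K := by positivity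
    congr 1
    rw [mul_left_comm, ← Real.rpow_add hn, show -p + (p - 1) = -1 by ring, Real.rpow_neg_one,
      one_div]
  · intro n hn
    have : 0 ≤ n := by linarith
    positivity
  · intro n hn
    have hn1 : 1 ≤ n := hK.trans hn
    have hn0 : 0 < n := by linarith
    have hB := one_add_div_le_add_one_div_rpow hn0 hp1'.le
    have h1 : n ^ (p - 1) * ((n + 1) / n) ^ (p - 1) = (n + 1) ^ (p - 1) := by
      rw [← Real.mul_rpow hn0.le (by positivity)]
      congr 1
      field_simp
    have h2 : n ^ (p - 1) ≤ (n + 1) ^ (p - 1) * ((n + 1) / (n + p)) := by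
      have h3 : n ^ (p - 1) * (1 + (p - 1) / (n + 1)) ≤ (n + 1) ^ (p - 1) := by
        rw [← h1]; gcongr
      rw [← mul_div_assoc, le_div_iff₀ (by positivity)]
      calc n ^ (p - 1) * (n + p) = n ^ (p - 1) * (1 + (p - 1) / (n + 1)) * (n + 1) := by
            field_simp; ring
        _ ≤ _ := by gcongr
    have h3 : (n + 1) ^ (-p) * (n + 1) ^ (p - 1) = 1 / (n + 1) := by
      rw [← Real.rpow_add (by positivity), show -p + (p - 1) = -1 by ring, Real.rpow_neg_one,
        one_div]
    -- Both factors are at most `2 * n`; the second uses `p ≤ K ≤ n`.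
    have h4 : (n + 1) * (n + p) ≤ 4 * n ^ 2 := by
      have : p ≤ n := hpK.trans hn
      nlinarith
    calc e / n ^ 2 ≤ 4 * e / ((n + 1) * (n + p)) := by
          rw [div_le_div_iff₀ (by positivity) (by positivity)]
          linarith [mul_le_mul_of_nonneg_left h4 he]
      _ = 4 * e / (p - 1) * (1 / (n + 1) * ((p - 1) / (n + p))) := by field_simp
      _ = (n + 1) ^ (-p) * (4 * e / (p - 1)
            * ((n + 1) ^ (p - 1) - (n + 1) ^ (p - 1) * ((n + 1) / (n + p)))) := by
          rw [← h3]; field_simp; ring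
      _ ≤ (n + 1) ^ (-p) * (4 * e / (p - 1) * ((n + 1) ^ (p - 1) - n ^ (p - 1))) := by gcongr
      _ = _ := by ring

theorem constant_recursion_le {u : ℕ → ℝ} {q e : ℝ} (hq : 0 < q) (hq1 : q ≤ 1) (he : 0 ≤ e)
    (hu : ∀ k : ℕ, u (k + 1) ≤ (1 - q) * u k + e) (k : ℕ) :
    u k ≤ u 0 * (1 - q) ^ k + e / q := by
  refine le_of_linear_recursion (q := fun _ => q) (e := fun _ => e)
    (b := fun k => u 0 * (1 - q) ^ k + e / q) (fun _ => hq1) hu ?_ (fun k => ?_) k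
  · have : 0 ≤ e / q := by positivity
    simpa using this
  · refine le_of_eq ?_
    field_simp
    ring

/-- Bernoulli's inequality for exponents in `[0, 1]`. It bounds the sum of the decaying steps from
below by a telescoping sum. -/
theorem add_one_rpow_sub_rpow_le {n s : ℝ} (hn : 0 < n) (hs : 0 ≤ s) (hs1 : s ≤ 1) :
    (n + 1) ^ s - n ^ s ≤ s * n ^ (s - 1) := by
  have h := rpow_one_add_le_one_add_mul_self (s := 1 / n) (p := s)
    (by have : 0 < 1 / n := by positivity
        linarith) hs hs1
  have h1 : (n + 1) ^ s = n ^ s * (1 + 1 / n) ^ s := by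
    rw [← Real.mul_rpow hn.le (by positivity)]
    congr 1
    field_simp
  rw [h1, Real.rpow_sub_one hn.ne']
  have h2 := mul_le_mul_of_nonneg_left h (Real.rpow_nonneg hn.le s)
  calc _ ≤ n ^ s * (1 + s * (1 / n)) - n ^ s := by linarith
    _ = _ := by field_simp; ring

/-- The recursion with polynomially decaying steps `α / (k + K) ^ ξ`, `0 < ξ < 1`. -/
theorem polynomial_recursion_le {u : ℕ → ℝ} {K α γ ξ D : ℝ} (hK : 1 ≤ K) (hα : 0 < α)
    (hγ : 0 < γ) (hξ : 0 < ξ) (hξ1 : ξ < 1) (hD : 0 ≤ D) (hu0 : 0 ≤ u 0)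
    (hq : ∀ k : ℕ, α / ((k : ℝ) + K) ^ ξ * γ / 2 ≤ 1)
    (hu : ∀ k : ℕ, u (k + 1) ≤ (1 - α / ((k : ℝ) + K) ^ ξ * γ / 2) * u k
      + (α / ((k : ℝ) + K) ^ ξ) ^ 2 * D)
    (hKξ : 4 * ξ / (α * γ) ≤ K ^ (1 - ξ)) (k : ℕ) :
    u k ≤ u 0 * Real.exp (-(α * γ / (2 * (1 - ξ))) * (((k : ℝ) + K) ^ (1 - ξ) - K ^ (1 - ξ)))
      + 4 * D / γ * (α / ((k : ℝ) + K) ^ ξ) := by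
  have hs : 0 < 1 - ξ := by linarith
  refine le_of_linear_recursion (q := fun k : ℕ => α / ((k : ℝ) + K) ^ ξ * γ / 2)
    (e := fun k : ℕ => (α / ((k : ℝ) + K) ^ ξ) ^ 2 * D)
    (b := fun k : ℕ => u 0 * Real.exp (-(α * γ / (2 * (1 - ξ)))
      * (((k : ℝ) + K) ^ (1 - ξ) - K ^ (1 - ξ))) + 4 * D / γ * (α / ((k : ℝ) + K) ^ ξ))
    hq hu ?_ (fun k => ?_) k
  · have : 0 ≤ 4 * D / γ * (α / K ^ ξ) := by positivity
    simpa using this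
  · have hk : (0 : ℝ) ≤ k := k.cast_nonneg
    have hKn : K ≤ k + K := by linarith
    push_cast
    rw [show (k : ℝ) + 1 + K = k + K + 1 by ring]
    set n : ℝ := k + K with hn
    have hnpos : 0 < n := by linarith
    have hnξ : 0 < n ^ ξ := by positivity
    have h1 : 1 - α / n ^ ξ * γ / 2
        ≤ Real.exp (-(α * γ / (2 * (1 - ξ))) * ((n + 1) ^ (1 - ξ) - n ^ (1 - ξ))) := by
      refine le_trans ?_ (Real.add_one_le_exp _)
      have h2 := add_one_rpow_sub_rpow_le hnpos hs.le (by linarith)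
      rw [show 1 - ξ - 1 = -ξ by ring, Real.rpow_neg hnpos.le] at h2
      have h3 := mul_le_mul_of_nonneg_left h2
        (by positivity : 0 ≤ α * γ / (2 * (1 - ξ)))
      have h4 : α * γ / (2 * (1 - ξ)) * ((1 - ξ) * (n ^ ξ)⁻¹) = α / n ^ ξ * γ / 2 := by
        field_simp
      linarith
    have h2 : (1 - α / n ^ ξ * γ / 2) * Real.exp (-(α * γ / (2 * (1 - ξ)))
        * (n ^ (1 - ξ) - K ^ (1 - ξ)))
        ≤ Real.exp (-(α * γ / (2 * (1 - ξ))) * ((n + 1) ^ (1 - ξ) - K ^ (1 - ξ))) := by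
      calc _ ≤ Real.exp (-(α * γ / (2 * (1 - ξ))) * ((n + 1) ^ (1 - ξ) - n ^ (1 - ξ)))
            * Real.exp (-(α * γ / (2 * (1 - ξ))) * (n ^ (1 - ξ) - K ^ (1 - ξ))) := by gcongr
        _ = _ := by
          rw [← Real.exp_add]
          congr 1
          ring
    have h3 := mul_le_mul_of_nonneg_left h2 hu0
    -- The noise term of the supersolution is twice the quasi-stationary level `2 * D / γ * (α / n ^
    -- ξ)`. One contraction therefore frees `2 * (α / n ^ ξ) ^ 2 * D` (`h6`): half pays for the new
    -- noise, half for the decrease of the step size bounded here. The lower bound on `K` makes that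
    -- decrease small enough.
    have h4 : 4 / γ * (α / n ^ ξ - α / (n + 1) ^ ξ) ≤ (α / n ^ ξ) ^ 2 := by
      have hA := one_sub_div_le_div_add_one_rpow hnpos hξ.le
      rw [Real.div_rpow hnpos.le (by positivity)] at hA
      have hKn' : 4 * ξ / (α * γ) ≤ n ^ (1 - ξ) :=
        hKξ.trans (Real.rpow_le_rpow (by linarith) hKn hs.le)
      rw [Real.rpow_sub hnpos, Real.rpow_one, div_le_div_iff₀ (by positivity) hnξ] at hKn'
      calc 4 / γ * (α / n ^ ξ - α / (n + 1) ^ ξ)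
          = 4 / γ * (α / n ^ ξ) * (1 - n ^ ξ / (n + 1) ^ ξ) := by field_simp
        _ ≤ 4 / γ * (α / n ^ ξ) * (ξ / n) := by
          gcongr
          linarith
        _ = 4 * ξ * n ^ ξ * (α / (γ * n * (n ^ ξ) ^ 2)) := by field_simp
        _ ≤ n * (α * γ) * (α / (γ * n * (n ^ ξ) ^ 2)) := by gcongr
        _ = _ := by field_simp
    have h5 := mul_le_mul_of_nonneg_right h4 hD
    have h6 : α / n ^ ξ * γ / 2 * (4 * D / γ * (α / n ^ ξ)) = 2 * ((α / n ^ ξ) ^ 2 * D) := by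
      field_simp
      ring
    have h7 : 4 / γ * (α / n ^ ξ - α / (n + 1) ^ ξ) * D
      = 4 * D / γ * (α / n ^ ξ) - 4 * D / γ * (α / (n + 1) ^ ξ) := by ring
    have h8 : 0 ≤ (α / n ^ ξ) ^ 2 * D := by positivity
    linarith

/-! ### Size of the drift constant -/

/-- At `μ = 0` the constant equals the stated upper bound, which is positive; continuity gives
positivity nearby, and every `μ > 0` strictly lowers the value. -/
theorem exists_forall_driftConst_pos {a γ C G C₁ C₂ : ℝ} (ha : 0 < a) (hγ : 0 < γ) (hC : 0 < C)
    (hG : 0 < G) (hC₁ : 0 < C₁) (hC₂ : 0 < C₂) :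
    ∃ μ₀ : ℝ, 0 < μ₀ ∧ ∀ μ : ℝ, 0 < μ → μ < μ₀ →
      0 < driftConst a γ C G C₁ C₂ μ ∧
        driftConst a γ C G C₁ C₂ μ < 2 * γ / a * (C₁ / C₂) ^ (2 / a) := by
  have hGM := gradientConst_pos (C₂ := C₂) ha hG hC₁
  have hc₁ : 0 < C₁ ^ (2 / a) := Real.rpow_pos_of_pos hC₁ _
  have hc₂ : 0 < C₂ ^ (-(2 / a)) := Real.rpow_pos_of_pos hC₂ _
  unfold driftConst
  set GM := gradientConst a G C₁ C₂
  have hcont : ContinuousAt (fun μ : ℝ => (2 * γ * C₁ ^ (2 / a) / (a * (1 + μ * GM) ^ 2)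
      - μ * C * GM ^ 2) * C₂ ^ (-(2 / a))) 0 := by
    have h0 : a * (1 + 0 * GM) ^ 2 ≠ 0 := by simpa using ha.ne'
    fun_prop (disch := exact h0)
  have hev := hcont.eventually (lt_mem_nhds (a := 0) (by simp; positivity))
  obtain ⟨ε, hε, hball⟩ := Metric.eventually_nhds_iff.mp hev
  refine ⟨ε, hε, fun μ hμ hμε => ⟨hball ?_, ?_⟩⟩
  · rwa [Real.dist_eq, sub_zero, abs_of_pos hμ]
  · have h1 : 2 * γ / a * (C₁ / C₂) ^ (2 / a)
        = 2 * γ * C₁ ^ (2 / a) / a * C₂ ^ (-(2 / a)) := by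
      rw [Real.div_rpow hC₁.le hC₂.le, Real.rpow_neg hC₂.le]
      field_simp
    rw [h1]
    refine mul_lt_mul_of_pos_right ?_ hc₂
    have h2 : 2 * γ * C₁ ^ (2 / a) / (a * (1 + μ * GM) ^ 2) ≤ 2 * γ * C₁ ^ (2 / a) / a := by
      refine div_le_div_of_nonneg_left (by positivity) ha (le_mul_of_one_le_right ha.le ?_)
      have : 0 < μ * GM := by positivity
      nlinarith
    have h3 : 0 < μ * C * GM ^ 2 := by positivity
    linarith

/-- A Lipschitz vector field cannot have a drift constant that is too large. -/
theorem sq_drift_mul_le {d : ℕ} {F : EuclideanSpace ℝ (Fin d) → EuclideanSpace ℝ (Fin d)} {C : ℝ}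
    {xs : EuclideanSpace ℝ (Fin d)} (hFxs : F xs = 0)
    (hF : ∀ x y, ‖F x - F y‖ ≤ C * ‖x - y‖)
    {R : EuclideanSpace ℝ (Fin d) → ℝ} (hR : ∀ x, 0 ≤ R x) (hRc : Continuous R)
    {c₁ μ γ : ℝ} (hc₁ : 0 < c₁) (hγ : 0 < γ)
    (hR₁ : ∀ x, c₁ * ‖x - xs‖ ^ 2 ≤ R x) (hμ : 0 < μ)
    (hdrift : ∀ x u, moreauEnvelope R μ x = R u + ‖x - u‖ ^ 2 / (2 * μ) →
      inner ℝ (μ⁻¹ • (x - u)) (F x) ≤ -γ * moreauEnvelope R μ x)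
    {x : EuclideanSpace ℝ (Fin d)} (hx : x ≠ xs) :
    γ ^ 2 * μ ≤ 2 * C ^ 2 * (1 / c₁ + 2 * μ) := by
  obtain ⟨u, hu⟩ := exists_moreauEnvelope_eq hR hRc hμ x
  have h1 := hdrift x u hu
  have h2 := sq_norm_sub_le_moreauEnvelope hc₁ hR₁ hμ x
  have hρ : 0 < ‖x - xs‖ ^ 2 := by
    have := norm_pos_iff.mpr (sub_ne_zero.mpr hx)
    positivity
  set M := moreauEnvelope R μ x
  set c := 1 / c₁ + 2 * μ with hc
  have hcpos : 0 < c := by positivity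
  have hM : 0 < M := pos_of_mul_pos_right (hρ.trans_le h2) hcpos.le
  have h3 : ‖x - u‖ ^ 2 ≤ 2 * μ * M := by
    rw [← div_le_iff₀' (by positivity), hu]
    linarith [hR u]
  have h4 : ‖F x‖ ≤ C * ‖x - xs‖ := by simpa [hFxs] using hF x xs
  -- Cauchy–Schwarz in the drift inequality. Both distances on the right are at most multiples of
  -- `√M`, so after squaring a positive factor `M ^ 2` cancels.
  have h5 : γ * M ≤ μ⁻¹ * ‖x - u‖ * (C * ‖x - xs‖) := by
    have := neg_le_of_abs_le (abs_real_inner_le_norm (μ⁻¹ • (x - u)) (F x))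
    rw [norm_smul, Real.norm_of_nonneg (inv_pos.2 hμ).le] at this
    have h6 : μ⁻¹ * ‖x - u‖ * ‖F x‖ ≤ μ⁻¹ * ‖x - u‖ * (C * ‖x - xs‖) := by gcongr
    linarith
  have h6 : (γ * M) ^ 2 ≤ (μ⁻¹ * ‖x - u‖ * (C * ‖x - xs‖)) ^ 2 := by gcongr
  have h7 : (μ⁻¹ * ‖x - u‖ * (C * ‖x - xs‖)) ^ 2 ≤ (μ⁻¹ ^ 2 * (2 * μ * M)) * (C ^ 2 * (c * M)) := by
    rw [mul_pow, mul_pow, mul_pow]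
    gcongr
  have h8 : (μ⁻¹ ^ 2 * (2 * μ * M)) * (C ^ 2 * (c * M)) = 2 * C ^ 2 * c / μ * M ^ 2 := by
    field_simp
  rw [h8] at h7
  have h9 : γ ^ 2 * M ^ 2 ≤ 2 * C ^ 2 * c / μ * M ^ 2 := by rw [← mul_pow]; exact h6.trans h7
  have h10 := le_of_mul_le_mul_right h9 (by positivity)
  rwa [le_div_iff₀ hμ] at h10

/-! ### Measurability and integrability of the iterates -/

section Iterates

variable {d : ℕ} {F : EuclideanSpace ℝ (Fin d) → EuclideanSpace ℝ (Fin d)}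
  {Ω : Type*} [MeasurableSpace Ω] {P : Measure Ω} {x w : ℕ → Ω → EuclideanSpace ℝ (Fin d)}
  {β : ℕ → ℝ}

theorem measurable_iterate (hF : Continuous F) (hx0 : Measurable (x 0))
    (hw : ∀ k, Measurable (w k))
    (hstep : ∀ k ω, x (k + 1) ω = x k ω + β k • (F (x k ω) + w k ω)) (k : ℕ) :
    Measurable (x k) := by
  induction k with
  | zero => exact hx0
  | succ k ih =>
    have h : x (k + 1) = fun ω => x k ω + β k • (F (x k ω) + w k ω) := funext (hstep k)
    rw [h]
    exact ih.add (((hF.measurable.comp ih).add (hw k)).const_smul (β k))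

theorem memLp_lipschitz_comp [IsFiniteMeasure P] {C : ℝ} {xs : EuclideanSpace ℝ (Fin d)}
    (hFxs : F xs = 0) (hFC : Continuous F) (hF : ∀ x y, ‖F x - F y‖ ≤ C * ‖x - y‖)
    {X : Ω → EuclideanSpace ℝ (Fin d)} (hX : MemLp X 2 P) : MemLp (fun ω => F (X ω)) 2 P :=
  (hX.sub (memLp_const xs)).of_le_mul (c := C)
    (hFC.comp_aestronglyMeasurable hX.aestronglyMeasurable)
    (Eventually.of_forall fun ω => by simpa [hFxs] using hF (X ω) xs)

theorem memLp_iterate [IsFiniteMeasure P] {C : ℝ} {xs : EuclideanSpace ℝ (Fin d)}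
    (hFxs : F xs = 0) (hFC : Continuous F) (hF : ∀ x y, ‖F x - F y‖ ≤ C * ‖x - y‖)
    (hx0 : MemLp (x 0) 2 P) (hw : ∀ k, MemLp (w k) 2 P)
    (hstep : ∀ k ω, x (k + 1) ω = x k ω + β k • (F (x k ω) + w k ω)) (k : ℕ) :
    MemLp (x k) 2 P := by
  induction k with
  | zero => exact hx0
  | succ k ih =>
    have h : x (k + 1) = fun ω => x k ω + β k • (F (x k ω) + w k ω) := funext (hstep k)
    rw [h]
    exact ih.add (((memLp_lipschitz_comp hFxs hFC hF ih).add (hw k)).const_smul (β k))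

theorem history_le (hx : ∀ k, Measurable (x k)) (hw : ∀ k, Measurable (w k)) (k : ℕ) :
    history x w k ≤ ‹MeasurableSpace Ω› :=
  sup_le (iSup₂_le fun i _ => (hx i).comap_le) (iSup₂_le fun i _ => (hw i).comap_le)

end Iterates

theorem stronglyMeasurable_history {d : ℕ} {Ω : Type*}
    (x w : ℕ → Ω → EuclideanSpace ℝ (Fin d)) (k : ℕ) :
    StronglyMeasurable[history x w k] (x k) := by
  refine Measurable.stronglyMeasurable ?_
  refine Measurable.mono (comap_measurable (x k)) ?_ le_rfl
  exact le_sup_of_le_left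
    (le_iSup₂_of_le (f := fun i (_ : i ∈ Iic k) => MeasurableSpace.comap (x i) inferInstance)
      k self_mem_Iic le_rfl)


/-! ### Mean square bounds and the main theorem -/

/-- Mean square bounds from a linear recursion for the mean of the envelope. -/
theorem mean_square_bounds {ρ u : ℕ → ℝ} {α ξ K γ c c₂ D ms : ℝ} (hα : 0 < α) (hK : 1 ≤ K)
    (hγ : 0 < γ) (hc : 0 < c) (hD : 0 ≤ D) (hms : 0 < ms) (hu0 : 0 ≤ u 0) (hρ : ∀ k, ρ k ≤ c * u k)
    (huρ : u 0 ≤ c₂ * ρ 0) (hmsγ : ms * γ ≤ 2)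
    (hu : ∀ k : ℕ, α / ((k : ℝ) + K) ^ ξ ≤ ms →
      u (k + 1) ≤ (1 - α / ((k : ℝ) + K) ^ ξ * γ / 2) * u k
        + (α / ((k : ℝ) + K) ^ ξ) ^ 2 * D) (k : ℕ) :
    (ξ = 1 → α / ms ≤ K →
      (α < 2 / γ → ρ k ≤ c₂ * c * ρ 0 * (K / (k + K)) ^ (α * γ / 2)
          + c * (8 * α ^ 2 / (2 - α * γ) * (1 / ((k : ℝ) + K) ^ (α * γ / 2)) * D)) ∧
      (α = 2 / γ → ρ k ≤ c₂ * c * ρ 0 * (K / (k + K)) ^ (α * γ / 2)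
          + c * (4 * α ^ 2 * Real.log (k + K) / (k + K) * D)) ∧
      (2 / γ < α → ρ k ≤ c₂ * c * ρ 0 * (K / (k + K)) ^ (α * γ / 2)
          + c * (8 * Real.exp 1 * α ^ 2 / (α * γ - 2) * (1 / (k + K)) * D))) ∧
    (0 < ξ → ξ < 1 → (α / ms) ^ (1 / ξ) ≤ K → (4 * ξ / (α * γ)) ^ (1 / (1 - ξ)) ≤ K →
      ρ k ≤ c₂ * c * ρ 0 * Real.exp (-(α * γ / (2 * (1 - ξ)))
            * (((k : ℝ) + K) ^ (1 - ξ) - K ^ (1 - ξ)))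
          + 4 * α * c / (γ * ((k : ℝ) + K) ^ ξ) * D) ∧
    (ξ = 0 → α ≤ ms →
      ρ k ≤ c₂ * c * ρ 0 * (1 - α * γ / 2) ^ k + c * (2 * α / γ * D)) := by
  have finish : ∀ {Z S : ℝ}, 0 ≤ Z → u k ≤ u 0 * Z + S → ρ k ≤ c₂ * c * ρ 0 * Z + c * S := by
    intro Z S hZ h
    have h1 := mul_le_mul_of_nonneg_left h hc.le
    have h2 := mul_le_mul_of_nonneg_left (mul_le_mul_of_nonneg_right huρ hZ) hc.le
    calc ρ k ≤ c * (u 0 * Z + S) := (hρ k).trans h1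
      _ ≤ c * (c₂ * ρ 0 * Z + S) := by linarith
      _ = _ := by ring
  have hq : ∀ β, β ≤ ms → β * γ / 2 ≤ 1 := fun β hβ => by
    have := mul_le_mul_of_nonneg_right hβ hγ.le
    linarith
  have hn : ∀ j : ℕ, K ≤ (j : ℝ) + K := fun j => by
    have : (0 : ℝ) ≤ j := j.cast_nonneg
    linarith
  have hK0 : 0 < K := by linarith
  have hnpos : ∀ j : ℕ, 0 < (j : ℝ) + K := fun j => hK0.trans_le (hn j)
  have hkn := hnpos k
  refine ⟨fun hξ hαK => ?_, fun hξ hξ1 hαK hKξ => ?_, fun hξ hαms => ?_⟩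
  · subst hξ
    simp only [Real.rpow_one] at hu
    have hst : ∀ j : ℕ, α / ((j : ℝ) + K) ≤ ms := fun j => by
      rw [div_le_comm₀ (hnpos j) hms]
      exact hαK.trans (hn j)
    -- The requirement `p ≤ K` of the harmonic recursion is the nonnegativity of the contraction
    -- factor at the first step.
    have hpK : α * γ / 2 ≤ K := by
      have := hq _ (hst 0)
      rw [Nat.cast_zero, zero_add, div_mul_eq_mul_div, div_div, div_le_one (by positivity)] at this
      linarith
    have hu' : ∀ j : ℕ, u (j + 1) ≤ (1 - (α * γ / 2) / (j + K)) * u j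
        + (α ^ 2 * D) / (j + K) ^ 2 := by
      intro j
      refine (hu j (hst j)).trans (le_of_eq ?_)
      have := (hnpos j).ne'
      field_simp
    have he : 0 ≤ α ^ 2 * D := by positivity
    have hp : 0 ≤ α * γ / 2 := by positivity
    have hZ : 0 ≤ (K / (k + K)) ^ (α * γ / 2) := by positivity
    refine ⟨fun h => ?_, fun h => ?_, fun h => ?_⟩
    · rw [lt_div_iff₀ hγ] at h
      refine finish hZ ((harmonic_recursion_le_of_lt_one hK hp hpK hu0 he hu' (by linarith)
        k).trans (le_of_eq ?_))
      have h1 : 2 - α * γ ≠ 0 := by linarith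
      have h2 : 1 - α * γ / 2 ≠ 0 := by linarith
      have h3 : 4 * (α ^ 2 * D) / (1 - α * γ / 2) = 8 * α ^ 2 / (2 - α * γ) * D := by
        field_simp
        ring
      rw [h3]
      ring
    · rw [eq_div_iff hγ.ne'] at h
      refine finish hZ ((harmonic_recursion_le_of_eq_one hK hpK hu0 he hu' (by linarith)
        k).trans (le_of_eq ?_))
      ring
    · rw [div_lt_iff₀ hγ] at h
      refine finish hZ ((harmonic_recursion_le_of_one_lt hK hpK hu0 he hu' (by linarith)
        k).trans ?_)
      have h1 : 0 < α * γ - 2 := by linarith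
      have h2 : 0 < α * γ / 2 - 1 := by linarith
      -- The recursion gives the constant 8 without the factor `Real.exp 1`, which is pure slack.
      have h3 : 4 * (α ^ 2 * D) / (α * γ / 2 - 1) = 8 * 1 * α ^ 2 / (α * γ - 2) * D := by
        field_simp
        ring
      rw [h3, mul_right_comm]
      gcongr
      exact Real.one_le_exp zero_le_one
  · have hst : ∀ j : ℕ, α / ((j : ℝ) + K) ^ ξ ≤ ms := fun j => by
      rw [div_le_comm₀ (Real.rpow_pos_of_pos (hnpos j) _) hms]
      rw [one_div, Real.rpow_inv_le_iff_of_pos (by positivity) hK0.le hξ] at hαK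
      exact hαK.trans (Real.rpow_le_rpow hK0.le (hn j) hξ.le)
    rw [one_div, Real.rpow_inv_le_iff_of_pos (by positivity) hK0.le (by linarith)] at hKξ
    have h := polynomial_recursion_le hK hα hγ hξ hξ1 hD hu0 (fun j => hq _ (hst j))
      (fun j => hu j (hst j)) hKξ k
    refine (finish (Real.exp_pos _).le h).trans (le_of_eq ?_)
    have : 0 < ((k : ℝ) + K) ^ ξ := by positivity
    field_simp
  · subst hξ
    simp only [Real.rpow_zero, div_one] at hu
    have h := constant_recursion_le (by positivity) (hq _ hαms) (by positivity)
      (fun j => hu j hαms) k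
    refine (finish (pow_nonneg (sub_nonneg.2 (hq _ hαms)) k) h).trans (le_of_eq ?_)
    field_simp

/-- The mean square bounds for a process that is identically zero. -/
theorem mean_square_bounds_zero {ρ : ℕ → ℝ} {α ξ K γ c c₂ D ms : ℝ} (hα : 0 < α) (hK : 1 ≤ K)
    (hγ : 0 < γ) (hc : 0 < c) (hD : 0 ≤ D) (hρ : ∀ k, ρ k = 0) (k : ℕ) :
    (ξ = 1 → α / ms ≤ K →
      (α < 2 / γ → ρ k ≤ c₂ * c * ρ 0 * (K / (k + K)) ^ (α * γ / 2)
          + c * (8 * α ^ 2 / (2 - α * γ) * (1 / ((k : ℝ) + K) ^ (α * γ / 2)) * D)) ∧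
      (α = 2 / γ → ρ k ≤ c₂ * c * ρ 0 * (K / (k + K)) ^ (α * γ / 2)
          + c * (4 * α ^ 2 * Real.log (k + K) / (k + K) * D)) ∧
      (2 / γ < α → ρ k ≤ c₂ * c * ρ 0 * (K / (k + K)) ^ (α * γ / 2)
          + c * (8 * Real.exp 1 * α ^ 2 / (α * γ - 2) * (1 / (k + K)) * D))) ∧
    (0 < ξ → ξ < 1 → (α / ms) ^ (1 / ξ) ≤ K → (4 * ξ / (α * γ)) ^ (1 / (1 - ξ)) ≤ K →
      ρ k ≤ c₂ * c * ρ 0 * Real.exp (-(α * γ / (2 * (1 - ξ)))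
            * (((k : ℝ) + K) ^ (1 - ξ) - K ^ (1 - ξ)))
          + 4 * α * c / (γ * ((k : ℝ) + K) ^ ξ) * D) ∧
    (ξ = 0 → α ≤ ms →
      ρ k ≤ c₂ * c * ρ 0 * (1 - α * γ / 2) ^ k + c * (2 * α / γ * D)) := by
  simp only [hρ, mul_zero, zero_mul, zero_add]
  have hk : (0 : ℝ) ≤ k := k.cast_nonneg
  refine ⟨fun _ _ => ⟨fun h => ?_, fun _ => ?_, fun h => ?_⟩, fun _ _ _ _ => ?_, fun _ _ => ?_⟩
  · rw [lt_div_iff₀ hγ] at h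
    have : 0 < 2 - α * γ := by linarith
    positivity
  · have := Real.log_nonneg (show 1 ≤ (k : ℝ) + K by linarith)
    positivity
  · rw [div_lt_iff₀ hγ] at h
    have : 0 < α * γ - 2 := by linarith
    positivity
  · positivity
  · positivity

theorem mainTheorem1 {d : ℕ}
    -- the closed loop drift, its equilibrium and the Lyapunov function
    (F : EuclideanSpace ℝ (Fin d) → EuclideanSpace ℝ (Fin d))
    (xs : EuclideanSpace ℝ (Fin d))
    (V : EuclideanSpace ℝ (Fin d) → ℝ)
    (a γ C G C₁ C₂ : ℝ)
    (ha : 0 < a) (hγ : 0 < γ) (hC : 0 < C) (hG : 0 < G) (hC₁ : 0 < C₁) (hC₂ : 0 < C₂)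
    (hFxs : F xs = 0)
    (hF : ∀ x y, ‖F x - F y‖ ≤ C * ‖x - y‖)
    (hV : LocallyLipschitz V)
    (hdrift : ∀ x, ∀ g ∈ clarkeGradient V x, inner ℝ g (F x) ≤ -γ * V x)
    (hgrowth : ∀ x, C₁ * ‖x - xs‖ ^ a ≤ V x ∧ V x ≤ C₂ * ‖x - xs‖ ^ a)
    (hgrad : ∀ x, ∀ g ∈ clarkeGradient V x, ‖g‖ ≤ G * ‖x - xs‖ ^ (a - 1))
    -- the stochastic approximation iterates and the noise
    {Ω : Type*} [MeasurableSpace Ω] (P : Measure Ω) [IsProbabilityMeasure P]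
    (x w : ℕ → Ω → EuclideanSpace ℝ (Fin d))
    (A B α ξ K : ℝ)
    (hA : 0 ≤ A) (hB : 0 ≤ B) (hα : 0 < α) (hK : 1 ≤ K)
    (hx0 : Measurable (x 0)) (hx0L2 : MemLp (x 0) 2 P)
    (hw : ∀ k, Measurable (w k)) (hwL2 : ∀ k, MemLp (w k) 2 P)
    (hstep : ∀ k ω, x (k + 1) ω = x k ω + (α / ((k : ℝ) + K) ^ ξ) • (F (x k ω) + w k ω))
    (hmean : ∀ k, P[w k | history x w k] =ᵐ[P] 0)
    (hvar : ∀ k, P[fun ω => ‖w k ω‖ ^ 2 | history x w k]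
      ≤ᵐ[P] fun ω => A + B * ‖x k ω‖ ^ 2) :
    -- `γ_M` is positive for all small `μ`
    (∃ μ₀ : ℝ, 0 < μ₀ ∧ ∀ μ : ℝ, 0 < μ → μ < μ₀ →
      0 < driftConst a γ C G C₁ C₂ μ ∧
        driftConst a γ C G C₁ C₂ μ < 2 * γ / a * (C₁ / C₂) ^ (2 / a)) ∧
    ∀ μ γM c D : ℝ, 0 < μ → γM = driftConst a γ C G C₁ C₂ μ → 0 < γM →
      c = envelopeConst a C₁ μ → D = (A + 2 * B * ‖xs‖ ^ 2) / μ →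
      -- `γ_M` is a drift constant of the Moreau envelope of `V ^ (2 / a)`
      (∀ y, ∀ g ∈ clarkeGradient (moreauEnvelope (fun z => V z ^ (2 / a)) μ) y,
        inner ℝ g (F y) ≤ -γM * moreauEnvelope (fun z => V z ^ (2 / a)) μ y) ∧
      -- the mean square bounds
      ∀ k : ℕ, Integrable (fun ω => ‖x k ω - xs‖ ^ 2) P ∧
        (ξ = 1 → α / maxStep a γ C G C₁ C₂ B μ ≤ K →
          (α < 2 / γM →
            ∫ ω, ‖x k ω - xs‖ ^ 2 ∂P ≤
              C₂ ^ (2 / a) * c * (∫ ω, ‖x 0 ω - xs‖ ^ 2 ∂P) * (K / (k + K)) ^ (α * γM / 2)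
              + c * (8 * α ^ 2 / (2 - α * γM) * (1 / ((k : ℝ) + K) ^ (α * γM / 2)) * D)) ∧
          (α = 2 / γM →
            ∫ ω, ‖x k ω - xs‖ ^ 2 ∂P ≤
              C₂ ^ (2 / a) * c * (∫ ω, ‖x 0 ω - xs‖ ^ 2 ∂P) * (K / (k + K)) ^ (α * γM / 2)
              + c * (4 * α ^ 2 * Real.log (k + K) / (k + K) * D)) ∧
          (2 / γM < α →
            ∫ ω, ‖x k ω - xs‖ ^ 2 ∂P ≤
              C₂ ^ (2 / a) * c * (∫ ω, ‖x 0 ω - xs‖ ^ 2 ∂P) * (K / (k + K)) ^ (α * γM / 2)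
              + c * (8 * Real.exp 1 * α ^ 2 / (α * γM - 2) * (1 / (k + K)) * D))) ∧
        (0 < ξ → ξ < 1 → (α / maxStep a γ C G C₁ C₂ B μ) ^ (1 / ξ) ≤ K →
          (4 * ξ / (α * γM)) ^ (1 / (1 - ξ)) ≤ K →
            ∫ ω, ‖x k ω - xs‖ ^ 2 ∂P ≤
              C₂ ^ (2 / a) * c * (∫ ω, ‖x 0 ω - xs‖ ^ 2 ∂P)
                * Real.exp (-(α * γM / (2 * (1 - ξ)))
                    * (((k : ℝ) + K) ^ (1 - ξ) - K ^ (1 - ξ)))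
              + 4 * α * c / (γM * ((k : ℝ) + K) ^ ξ) * D) ∧
        (ξ = 0 → α ≤ maxStep a γ C G C₁ C₂ B μ →
            ∫ ω, ‖x k ω - xs‖ ^ 2 ∂P ≤
              C₂ ^ (2 / a) * c * (∫ ω, ‖x 0 ω - xs‖ ^ 2 ∂P) * (1 - α * γM / 2) ^ k
              + c * (2 * α / γM * D)) := by
  refine ⟨exists_forall_driftConst_pos ha hγ hC hG hC₁ hC₂, ?_⟩
  rintro μ γM c D hμ rfl hγM rfl rfl
  have hFC : Continuous F :=
    (LipschitzWith.of_dist_le_mul (K := C.toNNReal) fun x y => by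
      rw [dist_eq_norm, dist_eq_norm, Real.coe_toNNReal _ hC.le]
      exact hF x y).continuous
  have hV0 : ∀ x, 0 ≤ V x := fun x => le_trans (by positivity) (hgrowth x).1
  set R : EuclideanSpace ℝ (Fin d) → ℝ := fun z => V z ^ (2 / a) with hRdef
  have hR0 : ∀ x, 0 ≤ R x := fun x => Real.rpow_nonneg (hV0 x) _
  have hRc : Continuous R := hV.continuous.rpow_const fun _ => Or.inr (by positivity)
  have hR := fun x => rpow_growth ha hC₁.le (norm_nonneg _) (hgrowth x).1 (hgrowth x).2 hC₂.le
  have hc₁ : 0 < C₁ ^ (2 / a) := Real.rpow_pos_of_pos hC₁ _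
  have hprox := fun (x u : EuclideanSpace ℝ (Fin d))
      (hu : moreauEnvelope R μ x = R u + ‖x - u‖ ^ 2 / (2 * μ)) =>
    inner_prox_le_driftConst ha hγ hC hG hC₁ hC₂ hFxs hF hV hdrift hgrowth hgrad hμ hγM hu
  refine ⟨fun y g hg => inner_le_of_mem_clarkeGradient_moreauEnvelope hFC hR0 hRc hμ hprox hg,
    fun k => ?_⟩
  have hxm := measurable_iterate hFC hx0 hw hstep
  have hxL := memLp_iterate hFxs hFC hF hx0L2 hwL2 hstep
  have hint : ∀ k, Integrable (fun ω => ‖x k ω - xs‖ ^ 2) P := fun k =>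
    ((hxL k).sub (memLp_const xs)).integrable_norm_pow two_ne_zero
  refine ⟨hint k, ?_⟩
  have hc : 0 < envelopeConst a C₁ μ := by unfold envelopeConst; positivity
  have hD : 0 ≤ (A + 2 * B * ‖xs‖ ^ 2) / μ := by positivity
  -- In the one-point space (`d = 0`) the hypotheses do not relate `γ` to `C`, so the contraction
  -- factor may be negative; there the mean squares vanish identically. Otherwise a point `z ≠ xs`
  -- bounds the drift constant.
  by_cases htriv : ∀ x, x = xs
  · refine mean_square_bounds_zero (ρ := fun k => ∫ ω, ‖x k ω - xs‖ ^ 2 ∂P) hα hK hγM hc hD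
      (fun k => ?_) k
    simp [fun ω => htriv (x k ω)]
  obtain ⟨z, hz⟩ := not_forall.mp htriv
  have hden : 0 < 2 * (C ^ 2 + 2 * B) * envelopeConst a C₁ μ := by positivity
  have hiM := fun k => integrable_moreauEnvelope_comp hR0 hRc (fun x => (hR x).2) hμ (hxL k)
  -- This makes `1 - β * γM / 2` nonnegative for every admissible step `β`, as the comparison
  -- principle requires.
  have hmsγ : maxStep a γ C G C₁ C₂ B μ * driftConst a γ C G C₁ C₂ μ ≤ 2 := by
    have h1 := sq_drift_mul_le hFxs hF hR0 hRc hc₁ hγM (fun x => (hR x).1) hμ hprox hz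
    change _ ≤ 2 * C ^ 2 * envelopeConst a C₁ μ at h1
    rw [maxStep, div_mul_eq_mul_div, div_le_iff₀ hden]
    have h2 : 0 ≤ B * envelopeConst a C₁ μ := by positivity
    have h3 : 0 ≤ C ^ 2 * envelopeConst a C₁ μ := by positivity
    linarith
  refine mean_square_bounds (ρ := fun k => ∫ ω, ‖x k ω - xs‖ ^ 2 ∂P)
    (ms := maxStep a γ C G C₁ C₂ B μ)
    (u := fun k => ∫ ω, moreauEnvelope R μ (x k ω) ∂P) hα hK hγM hc hD
    (div_pos (mul_pos hγM hμ) hden)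
    (integral_nonneg fun ω => moreauEnvelope_nonneg hR0 hμ _) (fun k => ?_) ?_ hmsγ
    (fun k hk => ?_) k
  · rw [← integral_const_mul]
    exact integral_mono (hint k) ((hiM k).const_mul _) fun ω =>
      sq_norm_sub_le_moreauEnvelope hc₁ (fun x => (hR x).1) hμ (x k ω)
  · rw [← integral_const_mul]
    exact integral_mono (hiM 0) ((hint 0).const_mul _) fun ω =>
      (moreauEnvelope_le_self hR0 hμ _).trans (hR _).2
  · have hβ : 0 ≤ α / ((k : ℝ) + K) ^ ξ := by positivity
    have hβle : α / ((k : ℝ) + K) ^ ξ * (2 * (C ^ 2 + 2 * B) * (1 / C₁ ^ (2 / a) + 2 * μ))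
        ≤ driftConst a γ C G C₁ C₂ μ * μ := by
      rwa [maxStep, le_div_iff₀ hden] at hk
    simp only [hstep]
    exact integral_moreauEnvelope_step_le (history_le hxm hw k) hC hFxs hFC hF hR0 hRc hc₁
      (fun x => (hR x).1) (fun x => (hR x).2) hμ hA hB hprox hβ hβle
      (stronglyMeasurable_history x w k) (hxL k) (memLp_lipschitz_comp hFxs hFC hF (hxL k))
      (hwL2 k) (hmean k) (hvar k)
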